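/- Let $K$ be a real Hilbert space. Let $\mathcal G(K)$ be the Grassmann manifold of $K$: the set of nonzero proper complemented subspaces of $K$, with the real analytic Banach manifold structure whose charts, one for each pair of complementary $E_0,F_0\in\mathcal G(K)$, send a complement $E=(I+T)(E_0)$ of $F_0$, $T\in\mathcal L(E_0,F_0)$, to $T$. Its tangent space at $E$ is identified, by means of the chart given by $(E,E^\perp)$, with $\mathcal L(E,E^\perp)$, so that the total space $\mathbf T(\mathcal G(K))$ of the tangent bundle, with its usual analytic manifold structure, is the set of pairs $(E,T)$ with $E\in\mathcal G(K)$ and $T\in\mathcal L(E,E^\perp)$. Let $\bar P_E:K\to E$ denote the orthogonal projection and $\mathcal L(K)$ the Banach space of bounded operators on $K$. A tangent vector $T\in\mathcal L(E,E^\perp)$ is also identified with the operator $\tilde T:=T^*\bar P_{E^\perp}\in\mathcal L(K)$, which vanishes on $E$ and has values in $E$; put $\langle S,T\rangle_{\mathcal L(K)}:=\tilde S\,\tilde T^{*}\in\mathcal L(K)$ for $S,T\in\mathcal L(E,E^\perp)$. (a) The assignment $(E,T)\mapsto (E,T\bar P_E)$ is a real analytic immersion (all differentials are injective with complemented range) of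 $\mathbf T(\mathcal G(K))$ into the trivial Banach bundle $\mathcal G(K)\times\mathcal L(K)\to\mathcal G(K)$, it covers the identity of $\mathcal G(K)$ and is linear on each fibre. It is a homeomorphism from $\mathbf T(\mathcal G(K))$ onto $$\{(E,S): E\in\mathcal G(K),\ S\in\mathcal L(K),\ S(E^\perp)=\{0\},\ S(K)\subseteq E^\perp\},$$ which is a real analytic Banach subbundle of the trivial bundle. (b) For every $x\in K$, $\langle S,T\rangle_x:=\langle\langle S,T\rangle_{\mathcal L(K)}\,x,x\rangle$ is a real analytic pseudo-metric on $\mathbf T(\mathcal G(K))$ (a symmetric positive semi-definite bilinear form on each tangent space, depending analytically on the base point). The family $(\langle\cdot,\cdot\rangle_x)_{x\in K}$ is separating: if $\langle S,S\rangle_x=0$ for all $x\in K$, then $S=0$. If $K$ is separable, there is a sequence $(x_n)$ in $K$ such that the countable family $(\langle\cdot,\cdot\rangle_{x_n})_n$ is already separating. (c) The set $\mathcal G(K)_{\mathrm{fin}}$ of finite dimensional members of $\mathcal G(K)$ is open in $\mathcal G(K)$, for $E\in\mathcal G(K)_{\mathrm{fin}}$ and $S,T\in\mathcal L(E,E^\perp)$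 the operator $\langle S,T\rangle_{\mathcal L(K)}$ has finite rank, and $\langle S,T\rangle_{\mathrm{fin}}:=\mathrm{Tr}\,\langle S,T\rangle_{\mathcal L(K)}$ is a real analytic Riemannian metric on $\mathbf T(\mathcal G(K)_{\mathrm{fin}})$: an inner product on each tangent space, inducing its topology and depending analytically on the base point. -/

import Mathlib

open Set Topology

universe u

noncomputable section

/-! ## Real analytic Banach manifolds modelled on varying Banach spaces -/

/-- A real analytic Banach manifold: a topological space with a family of charts onto open
subsets of real Banach spaces (which may vary with the chart), covering the space, with real
analytic transition maps.  As part of the data we pick a preferred chart around every point. -/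
class AnalyticBanachManifold (M : Type u) [TopologicalSpace M] where
  Idx : Type u
  Model : Idx → Type u
  normedAddCommGroup : ∀ i, NormedAddCommGroup (Model i)
  normedSpace : ∀ i, NormedSpace ℝ (Model i)
  completeSpace : ∀ i, CompleteSpace (Model i)
  chart : ∀ i, OpenPartialHomeomorph M (Model i)
  idxAt : M → Idx
  mem_source : ∀ x, x ∈ (chart (idxAt x)).source
  analytic : ∀ i j, AnalyticOnNhd ℝ (fun y => chart j ((chart i).symm y))
    ((chart i).target ∩ (chart i).symm ⁻¹' (chart j).source)

/-- An analytic atlas on a bare set: injective charts onto open subsets of Banach spaces such that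
all overlaps are open and all transition maps are real analytic. -/
structure AnalyticAtlas (M : Type u) where
  Idx : Type u
  Model : Idx → Type u
  normedAddCommGroup : ∀ i, NormedAddCommGroup (Model i)
  normedSpace : ∀ i, NormedSpace ℝ (Model i)
  completeSpace : ∀ i, CompleteSpace (Model i)
  chart : ∀ i, PartialEquiv M (Model i)
  idxAt : M → Idx
  mem_source : ∀ x, x ∈ (chart (idxAt x)).source
  isOpen_target : ∀ i, IsOpen (chart i).target
  isOpen_overlap : ∀ i j, IsOpen ((chart i).target ∩ (chart i).symm ⁻¹' (chart j).source)
  analytic : ∀ i j, AnalyticOnNhd ℝ (fun y => chart j ((chart i).symm y))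
    ((chart i).target ∩ (chart i).symm ⁻¹' (chart j).source)

namespace AnalyticAtlas

attribute [instance] AnalyticAtlas.normedAddCommGroup AnalyticAtlas.normedSpace
  AnalyticAtlas.completeSpace

variable {M : Type u} (A : AnalyticAtlas M)

/-- The topology of an atlas: a set is open iff it is open in every chart. -/
@[reducible] def topology : TopologicalSpace M where
  IsOpen U := ∀ i, IsOpen ((A.chart i).target ∩ (A.chart i).symm ⁻¹' U)
  isOpen_univ i := by simpa using A.isOpen_target i
  isOpen_inter U V hU hV i := by
    have := (hU i).inter (hV i)
    rwa [← inter_inter_distrib_left, ← preimage_inter] at this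
  isOpen_sUnion S hS i := by
    rw [preimage_sUnion, inter_iUnion₂]
    exact isOpen_biUnion fun U hU => hS U hU i

/-- For the topology of an atlas, its charts are homeomorphisms between open sets. -/
def homeoChart (i : A.Idx) : @OpenPartialHomeomorph M (A.Model i) A.topology _ :=
  letI := A.topology
  { toPartialEquiv := A.chart i
    open_source := fun j => A.isOpen_overlap j i
    open_target := A.isOpen_target i
    continuousOn_toFun := by
      have hs : IsOpen (A.chart i).source := fun j => A.isOpen_overlap j i
      refine (continuousOn_open_iff hs).2 fun V hV j => ?_
      have h := (A.analytic j i).continuousOn.isOpen_inter_preimage (A.isOpen_overlap j i) hV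
      convert h using 1
      ext y
      simp only [mem_inter_iff, mem_preimage]
      tauto
    continuousOn_invFun :=
      (continuousOn_open_iff (A.isOpen_target i)).2 fun _ hU => hU i }

/-- The manifold defined by an atlas. -/
@[reducible] def toManifold : @AnalyticBanachManifold M A.topology :=
  letI := A.topology
  { Idx := A.Idx
    Model := A.Model
    normedAddCommGroup := A.normedAddCommGroup
    normedSpace := A.normedSpace
    completeSpace := A.completeSpace
    chart := A.homeoChart
    idxAt := A.idxAt
    mem_source := A.mem_source
    analytic := A.analytic }

end AnalyticAtlas

namespace AnalyticBanachManifold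

attribute [reducible, instance] AnalyticBanachManifold.normedAddCommGroup
  AnalyticBanachManifold.normedSpace
attribute [instance] AnalyticBanachManifold.completeSpace

/-- A Banach space as a manifold with the identity as only chart. -/
instance ofBanach (Y : Type u) [NormedAddCommGroup Y] [NormedSpace ℝ Y] [CompleteSpace Y] :
    AnalyticBanachManifold Y where
  Idx := PUnit
  Model _ := Y
  normedAddCommGroup _ := inferInstance
  normedSpace _ := inferInstance
  completeSpace _ := inferInstance
  chart _ := OpenPartialHomeomorph.refl Y
  idxAt _ := PUnit.unit
  mem_source _ := mem_univ _
  analytic _ _ := fun _ _ => analyticAt_id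

/-- The product of two manifolds, with product charts. -/
instance prod (M N : Type u) [TopologicalSpace M] [AnalyticBanachManifold M]
    [TopologicalSpace N] [AnalyticBanachManifold N] : AnalyticBanachManifold (M × N) where
  Idx := Idx M × Idx N
  Model i := Model i.1 × Model i.2
  normedAddCommGroup _ := inferInstance
  normedSpace _ := inferInstance
  completeSpace _ := inferInstance
  chart i := (chart i.1).prod (chart i.2)
  idxAt x := (idxAt x.1, idxAt x.2)
  mem_source x := ⟨mem_source x.1, mem_source x.2⟩
  analytic i j := by
    rintro ⟨y, z⟩ ⟨⟨hy, hz⟩, hy', hz'⟩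
    exact ((analytic i.1 j.1 y ⟨hy, hy'⟩).comp_of_eq analyticAt_fst rfl).prod
      ((analytic i.2 j.2 z ⟨hz, hz'⟩).comp_of_eq analyticAt_snd rfl)

section Maps

variable {M N : Type u} [TopologicalSpace M] [AnalyticBanachManifold M]
  [TopologicalSpace N] [AnalyticBanachManifold N]

/-- `f` written in the preferred charts at `x` and `f x`. -/
def localRep (f : M → N) (x : M) : Model (idxAt x) → Model (idxAt (f x)) :=
  fun y => chart (idxAt (f x)) (f ((chart (idxAt x)).symm y))

/-- `f` is real analytic at `x`: it is continuous at `x` and analytic there in charts. -/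
def MapAnalyticAt (f : M → N) (x : M) : Prop :=
  ContinuousAt f x ∧ AnalyticAt ℝ (localRep f x) (chart (idxAt x) x)

/-- The tangent space at `x`, represented in the preferred chart at `x`. -/
abbrev TangentSp (x : M) : Type u := Model (idxAt x)

/-- The differential of `f` at `x`. -/
def differential (f : M → N) (x : M) : TangentSp x →L[ℝ] TangentSp (f x) :=
  fderiv ℝ (localRep f x) (chart (idxAt x) x)

/-- `f` is an analytic immersion: it is analytic, and all its differentials are injective with
(closed) complemented range. -/
def IsAnalyticImmersion (f : M → N) : Prop :=
  ∀ x, MapAnalyticAt f x ∧ Function.Injective (differential f x) ∧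
    (differential f x).range.ClosedComplemented

end Maps

section Tangent

variable {M : Type u} [TopologicalSpace M] [AnalyticBanachManifold M]

/-- The derivative at (the point corresponding to) `x` of the transition from chart `i` to
chart `j`; it is the change of coordinates for tangent vectors at `x`. -/
def coordChange (i j : Idx M) (x : M) : Model i →L[ℝ] Model j :=
  fderiv ℝ (fun y => chart j ((chart i).symm y)) (chart i x)

theorem hasFDerivAt_transition {i j : Idx M} {x : M} (hi : x ∈ (chart i).source)
    (hj : x ∈ (chart j).source) :
    HasFDerivAt (fun y => chart j ((chart i).symm y)) (coordChange i j x) (chart i x) :=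
  (analytic i j _ ⟨(chart i).map_source hi,
    by simpa [(chart i).left_inv hi] using hj⟩).differentiableAt.hasFDerivAt

theorem coordChange_self {i : Idx M} {x : M} (hi : x ∈ (chart i).source) (v : Model i) :
    coordChange i i x v = v := by
  have h : HasFDerivAt (fun y => chart i ((chart i).symm y)) (ContinuousLinearMap.id ℝ (Model i))
      (chart i x) := by
    refine (hasFDerivAt_id _).congr_of_eventuallyEq ?_
    filter_upwards [(chart i).open_target.mem_nhds ((chart i).map_source hi)] with y hy
    exact (chart i).right_inv hy
  rw [(hasFDerivAt_transition hi hi).unique h]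
  rfl

theorem coordChange_coordChange {i j k : Idx M} {x : M} (hi : x ∈ (chart i).source)
    (hj : x ∈ (chart j).source) (hk : x ∈ (chart k).source) (v : Model i) :
    coordChange j k x (coordChange i j x v) = coordChange i k x v := by
  have hx : chart j ((chart i).symm (chart i x)) = chart j x := by rw [(chart i).left_inv hi]
  have h1 := hasFDerivAt_transition hi hj
  have h2 := hasFDerivAt_transition hj hk
  rw [← hx] at h2
  have h3 := h2.comp (chart i x) h1
  have hU : (chart i).target ∩ (chart i).symm ⁻¹' (chart j).source ∈ 𝓝 (chart i x) :=
    ((chart i).isOpen_inter_preimage_symm (chart j).open_source).mem_nhds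
      ⟨(chart i).map_source hi, by simpa [(chart i).left_inv hi] using hj⟩
  have h4 : HasFDerivAt (fun y => chart k ((chart i).symm y))
      ((coordChange j k x).comp (coordChange i j x)) (chart i x) := by
    refine h3.congr_of_eventuallyEq ?_
    filter_upwards [hU] with y hy
    simp only [Function.comp_apply]
    rw [(chart j).left_inv hy.2]
  exact (DFunLike.congr_fun ((hasFDerivAt_transition hi hk).unique h4) v).symm

variable (M) in
/-- The total space of the tangent bundle: pairs of a point and a tangent vector there. -/
structure TangentTotal : Type u where
  base : M
  vec : TangentSp base

/-- The chart of the tangent bundle induced by a chart `φ` of the manifold: a tangent vector at `x`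
is sent to `φ x` together with its coordinates in the chart `φ`. -/
def tangentChart (i : Idx M) : PartialEquiv (TangentTotal M) (Model i × Model i) where
  toFun p := (chart i p.base, coordChange (idxAt p.base) i p.base p.vec)
  invFun z := ⟨(chart i).symm z.1, coordChange i _ ((chart i).symm z.1) z.2⟩
  source := {p | p.base ∈ (chart i).source}
  target := (chart i).target ×ˢ univ
  map_source' p hp := ⟨(chart i).map_source hp, mem_univ _⟩
  map_target' z hz := (chart i).map_target hz.1
  left_inv' := by
    rintro ⟨x, v⟩ hx
    have key : ∀ y : M, y = x → ∀ w, (⟨y, coordChange i (idxAt y) y w⟩ : TangentTotal M) =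
        ⟨x, coordChange i (idxAt x) x w⟩ := by rintro y rfl w; rfl
    refine (key _ ((chart i).left_inv hx) _).trans ?_
    rw [coordChange_coordChange (mem_source x) hx (mem_source x),
      coordChange_self (mem_source x)]
  right_inv' := by
    rintro ⟨y, w⟩ ⟨hy, -⟩
    have hy' := (chart i).map_target hy
    refine Prod.ext ((chart i).right_inv hy) ?_
    change coordChange _ i ((chart i).symm y) (coordChange i _ ((chart i).symm y) w) = w
    rw [coordChange_coordChange hy' (mem_source _) hy', coordChange_self hy']

theorem tangentChart_overlap (i j : Idx M) :
    (tangentChart i).target ∩ (tangentChart i).symm ⁻¹' (tangentChart j).source =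
      ((chart i).target ∩ (chart i).symm ⁻¹' (chart j).source) ×ˢ univ := by
  ext ⟨y, w⟩
  constructor
  · rintro ⟨⟨h1, -⟩, h2⟩
    exact ⟨⟨h1, h2⟩, mem_univ _⟩
  · rintro ⟨⟨h1, h2⟩, -⟩
    exact ⟨⟨h1, mem_univ _⟩, h2⟩

theorem tangentChart_transition (i j : Idx M) {z : Model i × Model i}
    (hz : z ∈ ((chart i).target ∩ (chart i).symm ⁻¹' (chart j).source) ×ˢ (univ : Set (Model i))) :
    tangentChart j ((tangentChart i).symm z) = (chart j ((chart i).symm z.1),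
      fderiv ℝ (fun y => chart j ((chart i).symm y)) z.1 z.2) := by
  obtain ⟨y, w⟩ := z
  obtain ⟨⟨hy, hyj⟩, -⟩ := hz
  have hy' := (chart i).map_target hy
  refine Prod.ext rfl ?_
  change coordChange (idxAt ((chart i).symm y)) j ((chart i).symm y)
    (coordChange i (idxAt ((chart i).symm y)) ((chart i).symm y) w) = _
  refine (coordChange_coordChange hy' (mem_source _) hyj _).trans ?_
  rw [coordChange, (chart i).right_inv hy]

variable (M) in
/-- The analytic atlas of the tangent bundle. -/
@[reducible] def tangentAtlas : AnalyticAtlas (TangentTotal M) where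
  Idx := Idx M
  Model i := Model i × Model i
  normedAddCommGroup _ := inferInstance
  normedSpace _ := inferInstance
  completeSpace _ := inferInstance
  chart := tangentChart
  idxAt p := idxAt p.base
  mem_source p := mem_source p.base
  isOpen_target i := (chart i).open_target.prod isOpen_univ
  isOpen_overlap i j := by
    rw [tangentChart_overlap]
    exact ((chart i).isOpen_inter_preimage_symm (chart j).open_source).prod isOpen_univ
  analytic i j := by
    rw [tangentChart_overlap]
    have hopen := ((chart i).isOpen_inter_preimage_symm (chart j).open_source).prod
      (isOpen_univ (X := Model i))
    intro z hz
    have h1 : AnalyticAt ℝ (fun z : Model i × Model i => chart j ((chart i).symm z.1)) z :=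
      (analytic i j z.1 hz.1).comp_of_eq analyticAt_fst rfl
    have h2 : AnalyticAt ℝ (fun z : Model i × Model i =>
        fderiv ℝ (fun y => chart j ((chart i).symm y)) z.1 z.2) z := by
      have h3 := ((analytic i j z.1 hz.1).fderiv).comp_of_eq (g := fderiv ℝ _)
        (f := fun z : Model i × Model i => z.1) (x := z) analyticAt_fst rfl
      exact ((ContinuousLinearMap.id ℝ (Model i →L[ℝ] Model j)).analyticAt_bilinear
        (_, _)).comp_of_eq (h3.prod analyticAt_snd) rfl
    refine (h1.prod h2).congr ?_
    filter_upwards [hopen.mem_nhds hz] with z' hz'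
    exact (tangentChart_transition i j hz').symm

instance : TopologicalSpace (TangentTotal M) := (tangentAtlas M).topology

instance : AnalyticBanachManifold (TangentTotal M) := (tangentAtlas M).toManifold

/-- A family of bilinear forms `g` on the tangent spaces is a real analytic pseudo-metric on
the tangent bundle of the open submanifold `U`: each `g x` is bilinear, symmetric and positive
semi-definite, and in every chart `(x, v, w) ↦ g x v w` is real analytic. -/
structure IsAnalyticPseudoMetricOn (U : Set M) (g : ∀ x : M, TangentSp x → TangentSp x → ℝ) :
    Prop where
  linear_left : ∀ x ∈ U, ∀ w, IsLinearMap ℝ (fun v => g x v w)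
  symm : ∀ x ∈ U, ∀ v w, g x v w = g x w v
  nonneg : ∀ x ∈ U, ∀ v, 0 ≤ g x v v
  analytic : ∀ i : Idx M, AnalyticOnNhd ℝ
    (fun z : Model i × Model i × Model i =>
      g ((chart i).symm z.1) (coordChange i _ ((chart i).symm z.1) z.2.1)
        (coordChange i _ ((chart i).symm z.1) z.2.2))
    (((chart i).target ∩ (chart i).symm ⁻¹' U) ×ˢ univ)

/-- A real analytic (Riemannian) metric on the tangent bundle of the open submanifold `U`:
a real analytic pseudo-metric whose values are inner products inducing the topology
of the tangent spaces. -/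
structure IsAnalyticMetricOn (U : Set M) (g : ∀ x : M, TangentSp x → TangentSp x → ℝ) : Prop
    extends IsAnalyticPseudoMetricOn U g where
  definite : ∀ x ∈ U, ∀ v, g x v v = 0 → v = 0
  bounded_below : ∀ x ∈ U, ∃ c : ℝ, 0 < c ∧ ∀ v, c * ‖v‖ ^ 2 ≤ g x v v

/-- A family of pseudo-metrics is separating: a tangent vector on which all of them vanish
is zero. -/
def IsSeparating {ι : Type*} (g : ι → ∀ x : M, TangentSp x → TangentSp x → ℝ) : Prop :=
  ∀ (x : M) (v : TangentSp x), (∀ a, g a x v v = 0) → v = 0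

/-- The family `W` of subspaces of `Y` is an analytic Banach subbundle of the trivial bundle
`M × Y`: the fibres are complemented, and near each point there is an analytic trivialization
`(x, y) ↦ (x, Θ x y)` of the trivial bundle carrying `U × W x₀` onto `{(x, y) | y ∈ W x}`. -/
def IsAnalyticSubbundle {Y : Type u} [NormedAddCommGroup Y] [NormedSpace ℝ Y] [CompleteSpace Y]
    (W : M → Submodule ℝ Y) : Prop :=
  ∀ x₀ : M, (W x₀).ClosedComplemented ∧ ∃ U : Set M, IsOpen U ∧ x₀ ∈ U ∧
    ∃ Θ : M → (Y ≃L[ℝ] Y), (∀ x ∈ U, MapAnalyticAt (fun x => (Θ x : Y →L[ℝ] Y)) x) ∧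
      ∀ x ∈ U, ∀ y : Y, Θ x y ∈ W x ↔ y ∈ W x₀

end Tangent

end AnalyticBanachManifold

/-! ## The Grassmann manifold of a real Hilbert space -/

/-- The Grassmannian: the nonzero proper complemented subspaces of `X`. -/
@[ext] structure Grassmannian (X : Type u) [NormedAddCommGroup X] [NormedSpace ℝ X] : Type u where
  space : Submodule ℝ X
  ne_bot : space ≠ ⊥
  ne_top : space ≠ ⊤
  complemented : space.ClosedComplemented

namespace Grassmannian

open Submodule

section Banach

variable {X : Type u} [NormedAddCommGroup X] [NormedSpace ℝ X]

instance [CompleteSpace X] (E : Grassmannian X) : CompleteSpace E.space :=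
  E.complemented.isClosed.completeSpace_coe

theorem isTopCompl_range {V : Type*} [NormedAddCommGroup V] [NormedSpace ℝ V]
    {E F : Submodule ℝ X} (h : IsTopCompl E F) (w : V →L[ℝ] X) (e : V ≃L[ℝ] E)
    (he : (e : V →L[ℝ] E) = E.projectionOntoL F h ∘L w) : IsTopCompl w.range F := by
  have he' : ∀ v, E.projectionOntoL F h (w v) = e v := fun v => by
    rw [← ContinuousLinearEquiv.coe_coe, he]; rfl
  set P : X →L[ℝ] X := w ∘L (e.symm : E →L[ℝ] V) ∘L E.projectionOntoL F h with hP
  have hPx : ∀ x, P x = w (e.symm (E.projectionOntoL F h x)) := fun x => rfl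
  have hPw : ∀ v, P (w v) = w v := fun v => by
    rw [hPx, he', e.symm_apply_apply]
  have hid : IsIdempotentElem P := by
    ext x
    exact hPw _
  have hr : P.range = w.range := by
    ext x
    constructor
    · rintro ⟨y, rfl⟩
      exact ⟨_, rfl⟩
    · rintro ⟨v, rfl⟩
      exact ⟨w v, hPw v⟩
  have hk : P.ker = F := by
    ext x
    rw [← projectionOntoL_apply_eq_zero_iff h]
    constructor
    · intro hx
      have h0 : w (e.symm (E.projectionOntoL F h x)) = 0 := hx
      have h1 := he' (e.symm (E.projectionOntoL F h x))
      rw [h0, map_zero, e.apply_symm_apply] at h1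
      exact h1.symm
    · intro hx
      change w (e.symm (E.projectionOntoL F h x)) = 0
      rw [hx, map_zero, map_zero]
  have := ContinuousLinearMap.IsIdempotentElem.isTopCompl hid
  rwa [hr, hk] at this

theorem exists_equiv {V : Type*} [NormedAddCommGroup V] [NormedSpace ℝ V]
    {E F : Submodule ℝ X} (h : IsTopCompl E F) (w : V →L[ℝ] X) (s : X →L[ℝ] V)
    (hs : ∀ v, s (w v) = v) (hw : IsTopCompl w.range F) :
    ∃ e : V ≃L[ℝ] E, (e : V →L[ℝ] E) = E.projectionOntoL F h ∘L w := by
  have hF : ∀ x, x ∈ F → E.projectionOntoL F h x = 0 := fun x =>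
    (projectionOntoL_apply_eq_zero_iff h).2
  have hF' : ∀ x, x ∈ F → w.range.projectionL F hw x = 0 := fun x =>
    (projectionL_apply_eq_zero_iff hw).2
  refine ⟨ContinuousLinearEquiv.equivOfInverse (E.projectionOntoL F h ∘L w)
    (s ∘L w.range.projectionL F hw ∘L E.subtypeL) ?_ ?_, rfl⟩
  · intro v
    change s (w.range.projectionL F hw (E.projectionL F h (w v))) = v
    have h1 : w.range.projectionL F hw (w v - E.projectionL F h (w v)) = 0 := by
      apply hF'
      rw [← projectionL_eq_self_sub_projectionL h]
      exact projectionL_apply_mem _ _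
    have h2 : w.range.projectionL F hw (w v) = w v :=
      (projectionL_eq_self_iff hw _).2 ⟨v, rfl⟩
    rw [map_sub, sub_eq_zero, h2] at h1
    rw [← h1, hs]
  · intro x
    change E.projectionOntoL F h (w (s (w.range.projectionL F hw x))) = x
    obtain ⟨v, hv⟩ : w.range.projectionL F hw x ∈ w.range := projectionL_apply_mem _ _
    have hv' : w v = w.range.projectionL F hw x := hv
    have h1 : E.projectionOntoL F h (x - w.range.projectionL F hw x) = 0 := by
      apply hF
      rw [← projectionL_eq_self_sub_projectionL hw]
      exact projectionL_apply_mem _ _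
    rw [map_sub, sub_eq_zero, projectionOntoL_apply_left] at h1
    rw [← hv', hs, hv', ← h1]

/-- For `T : E → F`, the map `I + T : E → X`. -/
def graphMap (E F : Submodule ℝ X) (T : E →L[ℝ] F) : E →L[ℝ] X :=
  E.subtypeL + F.subtypeL ∘L T

theorem proj_graphMap {E F : Submodule ℝ X} (h : IsTopCompl E F) (T : E →L[ℝ] F) (x : E) :
    E.projectionOntoL F h (graphMap E F T x) = x := by
  simp only [graphMap, _root_.add_apply, map_add]
  change E.projectionOntoL F h (x : X) + E.projectionOntoL F h (T x : X) = x
  rw [projectionOntoL_apply_left, projectionOntoL_apply_right, add_zero]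

theorem proj_graphMap' {E F : Submodule ℝ X} (h : IsTopCompl E F) (T : E →L[ℝ] F) (x : E) :
    F.projectionOntoL E h.symm (graphMap E F T x) = T x := by
  simp only [graphMap, _root_.add_apply, map_add]
  change F.projectionOntoL E h.symm (x : X) + F.projectionOntoL E h.symm (T x : X) = T x
  rw [projectionOntoL_apply_left, projectionOntoL_apply_right, zero_add]

theorem isTopCompl_graph {E F : Submodule ℝ X} (h : IsTopCompl E F) (T : E →L[ℝ] F) :
    IsTopCompl (graphMap E F T).range F :=
  isTopCompl_range h _ (ContinuousLinearEquiv.refl ℝ E) <| by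
    ext x : 1
    exact (proj_graphMap h T x).symm

/-- The subspace `(I + T)(E)` for `T : E → F`, as a point of the Grassmannian. -/
def graph (E F : Grassmannian X) (h : IsTopCompl E.space F.space) (T : E.space →L[ℝ] F.space) :
    Grassmannian X where
  space := (graphMap E.space F.space T).range
  ne_bot h0 := F.ne_top <| by
    simpa [h0] using (isTopCompl_graph h T).isCompl.sup_eq_top
  ne_top h1 := F.ne_bot <| by
    simpa [h1] using (isTopCompl_graph h T).isCompl.inf_eq_bot
  complemented := (isTopCompl_graph h T).closedComplemented

open Classical in
/-- The inverse of `graph`: for a complement `E₁` of `F`, the operator `T : E → F` with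
`E₁ = (I + T)(E)` is minus the projection onto `F` along `E₁`, restricted to `E`. -/
def coord (E F E₁ : Submodule ℝ X) : E →L[ℝ] F :=
  if h : IsTopCompl E₁ F then -(F.projectionOntoL E₁ h.symm ∘L E.subtypeL) else 0

theorem coord_range {V : Type*} [NormedAddCommGroup V] [NormedSpace ℝ V]
    {E F : Submodule ℝ X} (h : IsTopCompl E F) (w : V →L[ℝ] X) (e : V ≃L[ℝ] E)
    (he : (e : V →L[ℝ] E) = E.projectionOntoL F h ∘L w) :
    coord E F w.range = (F.projectionOntoL E h.symm ∘L w) ∘L (e.symm : E →L[ℝ] V) := by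
  have h1 := isTopCompl_range h w e he
  have he' : ∀ v, E.projectionOntoL F h (w v) = e v := fun v => by
    rw [← ContinuousLinearEquiv.coe_coe, he]; rfl
  rw [coord, dif_pos h1]
  ext x : 1
  obtain ⟨v, rfl⟩ := e.surjective x
  change -(F.projectionOntoL _ h1.symm (e v : X)) =
    F.projectionOntoL E h.symm (w (e.symm (e v)))
  rw [e.symm_apply_apply, neg_eq_iff_eq_neg, ← map_neg]
  have h2 : (e v : X) = w v + ((- F.projectionOntoL E h.symm (w v) : F) : X) := by
    have := projectionL_add_projectionL_eq_self h (w v)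
    rw [projectionL_apply, projectionL_apply, he'] at this
    rw [← eq_sub_iff_add_eq] at this
    rw [this, Submodule.coe_neg, sub_eq_add_neg]
  have h3 : F.projectionOntoL _ h1.symm (w v) = 0 :=
    (projectionOntoL_apply_eq_zero_iff h1.symm).2 ⟨v, rfl⟩
  rw [h2, map_add, projectionOntoL_apply_left, h3, zero_add, map_neg]

variable (X) in
/-- Pairs `(E, F)` of complementary points of the Grassmannian. -/
def ComplPair : Type u :=
  {p : Grassmannian X × Grassmannian X // IsTopCompl p.1.space p.2.space}

/-- The chart of the Grassmannian given by a complementary pair `(E, F)`: its domain consists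
of the complements of `F`, and it sends `(I + T)(E)` to `T : E → F`. -/
def grChart (i : ComplPair X) :
    PartialEquiv (Grassmannian X) (i.1.1.space →L[ℝ] i.1.2.space) where
  toFun E₁ := coord i.1.1.space i.1.2.space E₁.space
  invFun T := graph i.1.1 i.1.2 i.2 T
  source := {E₁ | IsTopCompl E₁.space i.1.2.space}
  target := univ
  map_source' _ _ := mem_univ _
  map_target' T _ := isTopCompl_graph i.2 T
  left_inv' := by
    intro E₁ (h1 : IsTopCompl E₁.space i.1.2.space)
    have hr : E₁.space.subtypeL.range = E₁.space := by
      ext x; simp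
    obtain ⟨e, he⟩ := exists_equiv i.2 E₁.space.subtypeL (E₁.space.projectionOntoL _ h1)
      (fun v => projectionOntoL_apply_left h1 v) (by rwa [hr])
    have hc := coord_range i.2 E₁.space.subtypeL e he
    rw [hr] at hc
    have he' : ∀ v : E₁.space, i.1.1.space.projectionOntoL _ i.2 (v : X) = e v := fun v => by
      rw [← ContinuousLinearEquiv.coe_coe, he]; rfl
    have key : ∀ v : E₁.space,
        graphMap i.1.1.space i.1.2.space (coord _ _ E₁.space) (e v) = v := fun v => by
      rw [hc]
      change (e v : X) + ((i.1.2.space.projectionOntoL i.1.1.space i.2.symm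
        ((e.symm (e v) : E₁.space) : X) : i.1.2.space) : X) = v
      rw [e.symm_apply_apply, ← he']
      exact projectionL_add_projectionL_eq_self i.2 (v : X)
    ext x
    constructor
    · rintro ⟨y, rfl⟩
      obtain ⟨v, rfl⟩ := e.surjective y
      have := key v
      change graphMap i.1.1.space i.1.2.space (coord _ _ E₁.space) (e v) ∈ E₁.space
      rw [this]
      exact v.2
    · intro hx
      exact ⟨e ⟨x, hx⟩, key ⟨x, hx⟩⟩
  right_inv' := by
    intro T _
    have hc := coord_range i.2 (graphMap i.1.1.space i.1.2.space T)
      (ContinuousLinearEquiv.refl ℝ _) (by ext x : 1; exact (proj_graphMap i.2 T x).symm)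
    refine hc.trans ?_
    ext x : 1
    exact proj_graphMap' i.2 T x

theorem graph_isTopCompl_iff (i j : ComplPair X) (T : i.1.1.space →L[ℝ] i.1.2.space) :
    IsTopCompl (graph i.1.1 i.1.2 i.2 T).space j.1.2.space ↔
      j.1.1.space.projectionOntoL j.1.2.space j.2 ∘L graphMap i.1.1.space i.1.2.space T ∈
        range ((↑) : (i.1.1.space ≃L[ℝ] j.1.1.space) → (i.1.1.space →L[ℝ] j.1.1.space)) :=
  ⟨fun h => exists_equiv j.2 _ _ (proj_graphMap i.2 T) h,
    fun ⟨e, he⟩ => isTopCompl_range j.2 _ e he⟩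

theorem analyticAt_graphMap (E F : Submodule ℝ X) {Z : Type*} [NormedAddCommGroup Z]
    [NormedSpace ℝ Z] (L : X →L[ℝ] Z) (T : E →L[ℝ] F) :
    AnalyticAt ℝ (fun T : E →L[ℝ] F => L ∘L graphMap E F T) T := by
  have : (fun T : E →L[ℝ] F => L ∘L graphMap E F T) = fun T =>
      L ∘L E.subtypeL + ContinuousLinearMap.compL ℝ E F Z (L ∘L F.subtypeL) T := by
    funext T
    ext x
    simp [graphMap]
  rw [this]
  exact analyticAt_const.add (ContinuousLinearMap.analyticAt _ T)

theorem isOpen_overlap [CompleteSpace X] (i j : ComplPair X) :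
    IsOpen ((grChart i).target ∩ (grChart i).symm ⁻¹' (grChart j).source) := by
  have h : (grChart i).target ∩ (grChart i).symm ⁻¹' (grChart j).source =
      (fun T => j.1.1.space.projectionOntoL j.1.2.space j.2 ∘L
        graphMap i.1.1.space i.1.2.space T) ⁻¹' range ((↑) :
        (i.1.1.space ≃L[ℝ] j.1.1.space) → (i.1.1.space →L[ℝ] j.1.1.space)) := by
    ext T
    exact (and_iff_right (mem_univ _)).trans (graph_isTopCompl_iff i j T)
  rw [h]
  exact ContinuousLinearEquiv.isOpen.preimage
    (continuous_iff_continuousAt.2 fun T => (analyticAt_graphMap _ _ _ T).continuousAt)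

theorem analytic_transition [CompleteSpace X] (i j : ComplPair X) :
    AnalyticOnNhd ℝ (fun T => grChart j ((grChart i).symm T))
      ((grChart i).target ∩ (grChart i).symm ⁻¹' (grChart j).source) := by
  intro T hT
  obtain ⟨e, he⟩ := (graph_isTopCompl_iff i j T).1 hT.2
  have h1 : AnalyticAt ℝ (fun T => ContinuousLinearMap.inverse
      (j.1.1.space.projectionOntoL j.1.2.space j.2 ∘L graphMap i.1.1.space i.1.2.space T)) T := by
    refine AnalyticAt.comp_of_eq (contDiffAt_map_inverse (n := ⊤) e).analyticAt
      (analyticAt_graphMap _ _ _ T) he.symm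
  have h2 := analyticAt_graphMap i.1.1.space i.1.2.space
    (j.1.2.space.projectionOntoL j.1.1.space j.2.symm) T
  have h3 := ((ContinuousLinearMap.compL ℝ j.1.1.space i.1.1.space
    j.1.2.space).analyticAt_bilinear (_, _)).comp_of_eq (h2.prod h1) rfl
  refine h3.congr ?_
  filter_upwards [(isOpen_overlap i j).mem_nhds hT] with S hS
  obtain ⟨e', he'⟩ := (graph_isTopCompl_iff i j S).1 hS.2
  refine Eq.trans ?_ (coord_range j.2 _ e' he').symm
  simp only [Function.comp_apply, ContinuousLinearMap.compL_apply]
  rw [← he', ContinuousLinearMap.inverse_equiv]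

end Banach

section Hilbert

variable {K : Type u} [NormedAddCommGroup K] [InnerProductSpace ℝ K] [CompleteSpace K]

/-- The orthogonal complement, as a point of the Grassmannian. -/
def perp (E : Grassmannian K) : Grassmannian K where
  space := E.spaceᗮ
  ne_bot h := E.ne_top (orthogonal_eq_bot_iff.1 h)
  ne_top h := E.ne_bot ((orthogonal_eq_top_iff _).1 h)
  complemented := (isTopCompl_orthogonal E.space).symm.closedComplemented

variable (K) in
/-- The analytic atlas of the Grassmannian, indexed by all complementary pairs; the preferred
chart at `E` is the one given by `E` and its orthogonal complement. -/
@[reducible] def atlas : AnalyticAtlas (Grassmannian K) where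
  Idx := ComplPair K
  Model i := i.1.1.space →L[ℝ] i.1.2.space
  normedAddCommGroup _ := inferInstance
  normedSpace _ := inferInstance
  completeSpace _ := inferInstance
  chart := grChart
  idxAt E := ⟨(E, E.perp), isTopCompl_orthogonal E.space⟩
  mem_source E := isTopCompl_orthogonal E.space
  isOpen_target _ := isOpen_univ
  isOpen_overlap := isOpen_overlap
  analytic := analytic_transition

instance : TopologicalSpace (Grassmannian K) := (atlas K).topology

instance : AnalyticBanachManifold (Grassmannian K) := (atlas K).toManifold

/-- The tangent space at `E` is the space of bounded operators `E → Eᗮ`. -/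
theorem tangentSp_eq (E : Grassmannian K) :
    AnalyticBanachManifold.TangentSp E = (E.space →L[ℝ] E.spaceᗮ) := rfl

/-! ### The embedding of the tangent bundle into the trivial bundle -/

/-- For a tangent vector `T : E → Eᗮ`, the operator `T ∘ P_E` on `K`, where `P_E : K → E` is
the orthogonal projection. -/
def extend (E : Grassmannian K) (T : E.space →L[ℝ] E.spaceᗮ) : K →L[ℝ] K :=
  E.spaceᗮ.subtypeL ∘L T ∘L E.space.orthogonalProjectionOnto

variable (K) in
/-- The map `(E, T) ↦ (E, T ∘ P_E)` from the total space of the tangent bundle. -/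
def tangentEmbedding (p : AnalyticBanachManifold.TangentTotal (Grassmannian K)) :
    Grassmannian K × (K →L[ℝ] K) :=
  (p.base, extend p.base p.vec)

/-- The operators on `K` vanishing on `Eᗮ` with values in `Eᗮ`. -/
def fibre (E : Grassmannian K) : Submodule ℝ (K →L[ℝ] K) where
  carrier := {S | (∀ x ∈ E.spaceᗮ, S x = 0) ∧ ∀ x, S x ∈ E.spaceᗮ}
  add_mem' {S T} hS hT := ⟨fun x hx => by simp [hS.1 x hx, hT.1 x hx],
    fun x => add_mem (hS.2 x) (hT.2 x)⟩
  zero_mem' := ⟨fun _ _ => rfl, fun _ => zero_mem _⟩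
  smul_mem' c S hS := ⟨fun x hx => by simp [hS.1 x hx], fun x => smul_mem _ c (hS.2 x)⟩

/-! ### The operator valued metric and the trace metric -/

/-- The identification of a tangent vector `T : E → Eᗮ` with an operator on `K` that vanishes on
`E` and takes values in `E`, namely the adjoint `T* : Eᗮ → E` extended by `0` on `E`. -/
def adjointExtend (E : Grassmannian K) (T : E.space →L[ℝ] E.spaceᗮ) : K →L[ℝ] K :=
  E.space.subtypeL ∘L ContinuousLinearMap.adjoint T ∘L E.spaceᗮ.orthogonalProjectionOnto

/-- The operator valued metric `⟨A, B⟩ = A B*`, on tangent vectors of the Grassmannian. -/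
def opMetric (E : Grassmannian K) (S T : E.space →L[ℝ] E.spaceᗮ) : K →L[ℝ] K :=
  adjointExtend E S ∘L ContinuousLinearMap.adjoint (adjointExtend E T)

/-- The form `⟨S, T⟩_x = ⟨⟨S, T⟩ x, x⟩` on the tangent spaces of the Grassmannian. -/
def vecMetric (x : K) (E : Grassmannian K) (S T : AnalyticBanachManifold.TangentSp E) : ℝ :=
  inner ℝ (opMetric E S T x) x

/-- The trace of a finite rank operator: the trace of its restriction to its range. -/
def finRankTrace (A : K →L[ℝ] K) : ℝ :=
  LinearMap.trace ℝ A.range (A.rangeRestrict.toLinearMap ∘ₗ A.range.subtype)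

/-- The form `⟨S, T⟩_fin = Tr ⟨S, T⟩` on the tangent spaces of the Grassmannian. -/
def traceMetric (E : Grassmannian K) (S T : AnalyticBanachManifold.TangentSp E) : ℝ :=
  finRankTrace (opMetric E S T)

variable (K) in
/-- The finite dimensional subspaces in the Grassmannian. -/
def finPart : Set (Grassmannian K) := {E | FiniteDimensional ℝ E.space}

end Hilbert

end Grassmannian

end

noncomputable section

namespace Grassmannian

open Submodule AnalyticBanachManifold

/-! ### Graph coordinates: a subspace as the graph of its coordinate operator -/

section Banach

variable {X : Type u} [NormedAddCommGroup X] [NormedSpace ℝ X]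

/-! The proof rests on two explicit formulas in a chart `(E₀, F₀)`, where `E` is the graph of `T :
E₀ → F₀`.

The oblique projection `Q` onto `E` along `F₀` is affine in `T`, and the orthogonal projection is `P
= Q (1 + Q - Q*)⁻¹` (`orthProj_eq_mul_inverse`). Hence `P` is analytic in `T`.

Differentiating the relation that defines a graph gives the change of coordinates for tangent
vectors without differentiating an inverse (`tangentCoordChange_apply`). For the pair `(E, Eᗮ)` it
turns a vector with coordinates `V` into the operator `(1 - P) V π P` on `K`, where `π` is the
projection onto `E₀` along `F₀` (`extend_tangentCoordChange`). So the embedding is analytic. Read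
backwards, the formula recovers `V` analytically from `T` and the operator (`chartRestrict`), and
this makes sense for every operator on `K`. In charts the embedding thus has an analytic left
inverse, which yields both the splitting of the differentials and the continuity of the inverse.
Conjugation by `P P₀ + (1 - P)(1 - P₀)` trivializes the image near `E₀`, with `P₀` the orthogonal
projection onto `E₀`.

For the metrics, `adjointExtend E S` is the adjoint of `extend E S`, so the operator metric is `(S
P)* (T P)`. Evaluated at `x` it gives the inner product of `S P x` and `T P x`; its trace is the
Hilbert–Schmidt inner product, which dominates the square of the operator norm on the diagonal. By
cyclicity the trace can be computed on the fixed space `E₀` of a chart, as a finite sum of analytic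
terms. -/

/-- The `E`-part of `v` is `v` minus its `F`-part, and the projection onto `F` along `E₁` kills `v`.
This linear relation characterizes `coord` and replaces the formula with an inverse operator. -/
theorem coord_projectionOntoL {E F E₁ : Submodule ℝ X} (h : IsTopCompl E F)
    (h₁ : IsTopCompl E₁ F) {v : X} (hv : v ∈ E₁) :
    coord E F E₁ (E.projectionOntoL F h v) = F.projectionOntoL E h.symm v := by
  rw [coord, dif_pos h₁]
  change -(F.projectionOntoL E₁ h₁.symm (E.projectionOntoL F h v : X)) = _
  have h2 : (E.projectionOntoL F h v : X) = v - (F.projectionOntoL E h.symm v : X) :=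
    eq_sub_of_add_eq (projectionL_add_projectionL_eq_self h v)
  have h3 : F.projectionOntoL E₁ h₁.symm v = 0 :=
    (projectionOntoL_apply_eq_zero_iff h₁.symm).2 hv
  rw [h2, map_sub, h3, projectionOntoL_apply_left, zero_sub, neg_neg]

theorem graphMap_coord_projectionOntoL {E F E₁ : Submodule ℝ X} (h : IsTopCompl E F)
    (h₁ : IsTopCompl E₁ F) {v : X} (hv : v ∈ E₁) :
    graphMap E F (coord E F E₁) (E.projectionOntoL F h v) = v := by
  change (E.projectionOntoL F h v : X) + (coord E F E₁ (E.projectionOntoL F h v) : X) = v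
  rw [coord_projectionOntoL h h₁ hv]
  exact projectionL_add_projectionL_eq_self h v

theorem graph_coord (i : ComplPair X) {E : Grassmannian X}
    (hE : IsTopCompl E.space i.1.2.space) :
    graph i.1.1 i.1.2 i.2 (coord i.1.1.space i.1.2.space E.space) = E :=
  (grChart i).left_inv hE

theorem coord_graph (i : ComplPair X) (T : i.1.1.space →L[ℝ] i.1.2.space) :
    coord i.1.1.space i.1.2.space (graph i.1.1 i.1.2 i.2 T).space = T :=
  (grChart i).right_inv (mem_univ T)

theorem graphMap_coord_mem (i : ComplPair X) {E : Grassmannian X}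
    (hE : IsTopCompl E.space i.1.2.space) (y : i.1.1.space) :
    graphMap i.1.1.space i.1.2.space (coord i.1.1.space i.1.2.space E.space) y ∈ E.space := by
  have h : graphMap i.1.1.space i.1.2.space (coord i.1.1.space i.1.2.space E.space) y ∈
      (graph i.1.1 i.1.2 i.2 (coord i.1.1.space i.1.2.space E.space)).space := ⟨y, rfl⟩
  rwa [graph_coord i hE] at h

theorem hasFDerivAt_graphMap_apply (E F : Submodule ℝ X) {Z : Type*} [NormedAddCommGroup Z]
    [NormedSpace ℝ Z] (L : X →L[ℝ] Z) (x : E) (T : E →L[ℝ] F) :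
    HasFDerivAt (fun T : E →L[ℝ] F => L (graphMap E F T x))
      ((L ∘L F.subtypeL) ∘L ContinuousLinearMap.apply ℝ F x) T := by
  have : (fun T : E →L[ℝ] F => L (graphMap E F T x)) = fun T =>
      L x + ((L ∘L F.subtypeL) ∘L ContinuousLinearMap.apply ℝ F x) T := by
    funext T
    simp [graphMap]
  rw [this]
  exact ((L ∘L F.subtypeL) ∘L ContinuousLinearMap.apply ℝ F x).hasFDerivAt.const_add _

end Banach

/-! ### Change of coordinates for tangent vectors -/

section Hilbert

variable {K : Type u} [NormedAddCommGroup K] [InnerProductSpace ℝ K] [CompleteSpace K]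

/-- The change of coordinates of the Grassmannian on tangent vectors at `E`. -/
def tangentCoordChange (i j : ComplPair K) (E : Grassmannian K) :
    (i.1.1.space →L[ℝ] i.1.2.space) →L[ℝ] (j.1.1.space →L[ℝ] j.1.2.space) :=
  coordChange (M := Grassmannian K) i j E

/-- Fix `x` and let `S` vary near `T`. The vector `(I + S) x` lies in the graph of `S`, so the
`j`-coordinate of that graph sends its first `j`-component to its second. Both components are affine
in `S`, and the product rule, applied in the direction `V`, can be solved for the derivative of the
transition map. The point `x` is chosen such that `(I + T) x` has first `j`-component `y`. -/
theorem tangentCoordChange_apply (i j : ComplPair K) {E : Grassmannian K}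
    (hi : IsTopCompl E.space i.1.2.space) (hj : IsTopCompl E.space j.1.2.space)
    (V : i.1.1.space →L[ℝ] i.1.2.space) (y : j.1.1.space) :
    tangentCoordChange i j E V y =
      j.1.2.space.projectionOntoL j.1.1.space j.2.symm
        (V (i.1.1.space.projectionOntoL i.1.2.space i.2
          (graphMap _ _ (coord j.1.1.space j.1.2.space E.space) y))) -
      coord j.1.1.space j.1.2.space E.space (j.1.1.space.projectionOntoL j.1.2.space j.2
        (V (i.1.1.space.projectionOntoL i.1.2.space i.2
          (graphMap _ _ (coord j.1.1.space j.1.2.space E.space) y)))) := by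
  set w := graphMap _ _ (coord j.1.1.space j.1.2.space E.space) y with hw
  have hwE : w ∈ E.space := graphMap_coord_mem j hj y
  set x := i.1.1.space.projectionOntoL i.1.2.space i.2 w with hx
  set T := coord i.1.1.space i.1.2.space E.space with hT
  have hgT : graph i.1.1 i.1.2 i.2 T = E := graph_coord i hi
  have hd : HasFDerivAt (fun S : i.1.1.space →L[ℝ] i.1.2.space =>
      coord j.1.1.space j.1.2.space (graph i.1.1 i.1.2 i.2 S).space)
      (tangentCoordChange i j E) T :=
    hasFDerivAt_transition (M := Grassmannian K) (i := i) (j := j) hi hj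
  have hA := hasFDerivAt_graphMap_apply i.1.1.space i.1.2.space
    (j.1.1.space.projectionOntoL j.1.2.space j.2) x T
  have hB := hasFDerivAt_graphMap_apply i.1.1.space i.1.2.space
    (j.1.2.space.projectionOntoL j.1.1.space j.2.symm) x T
  have h1 := hd.clm_apply hA
  have h2 : (fun S : i.1.1.space →L[ℝ] i.1.2.space =>
      coord j.1.1.space j.1.2.space (graph i.1.1 i.1.2 i.2 S).space
        (j.1.1.space.projectionOntoL j.1.2.space j.2 (graphMap _ _ S x))) =ᶠ[𝓝 T]
      fun S => j.1.2.space.projectionOntoL j.1.1.space j.2.symm (graphMap _ _ S x) := by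
    have hmem : T ∈ (grChart i).target ∩ (grChart i).symm ⁻¹' (grChart j).source := by
      refine ⟨mem_univ _, ?_⟩
      change IsTopCompl (graph i.1.1 i.1.2 i.2 T).space _
      rwa [hgT]
    filter_upwards [(isOpen_overlap i j).mem_nhds hmem] with S hS
    exact coord_projectionOntoL j.2 hS.2 ⟨x, rfl⟩
  have h3 := DFunLike.congr_fun (h1.unique (hB.congr_of_eventuallyEq h2)) V
  have hwx : graphMap _ _ T x = w := graphMap_coord_projectionOntoL i.2 hi hwE
  have hy : j.1.1.space.projectionOntoL j.1.2.space j.2 w = y := proj_graphMap j.2 _ y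
  rw [hgT, hwx, hy] at h3
  rw [eq_sub_iff_add_eq, add_comm]
  exact h3

/-- The preferred pair at `E`, namely `(E, Eᗮ)`. -/
abbrev orthPair (E : Grassmannian K) : ComplPair K :=
  ⟨(E, E.perp), isTopCompl_orthogonal E.space⟩

theorem coord_self (E : Grassmannian K) :
    coord E.space E.perp.space E.space = 0 := by
  ext x : 1
  have := coord_projectionOntoL (orthPair E).2 (orthPair E).2 x.2
  rw [projectionOntoL_apply_left, projectionOntoL_apply_right] at this
  exact this

theorem graphMap_coord_self (E : Grassmannian K) (x : E.space) :
    graphMap E.space E.perp.space (coord E.space E.perp.space E.space) x = x := by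
  rw [coord_self]
  simp [graphMap]

/-- A tangent vector in the chart `i`, as an operator on `K`. -/
def tangentOp (i : ComplPair K) : (i.1.1.space →L[ℝ] i.1.2.space) →L[ℝ] K →L[ℝ] K :=
  (ContinuousLinearMap.compL ℝ K i.1.2.space K i.1.2.space.subtypeL) ∘L
    (ContinuousLinearMap.compL ℝ K i.1.1.space i.1.2.space).flip
      (i.1.1.space.projectionOntoL i.1.2.space i.2)

/-- The orthogonal projection onto a point of the Grassmannian. -/
def orthProj (E : Grassmannian K) : K →L[ℝ] K := E.space.starProjection

theorem orthProj_mem (E : Grassmannian K) (x : K) : orthProj E x ∈ E.space :=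
  starProjection_apply_mem _ _

theorem orthProj_eq_self_iff (E : Grassmannian K) {x : K} : orthProj E x = x ↔ x ∈ E.space :=
  starProjection_eq_self_iff

theorem orthProj_eq_zero_iff (E : Grassmannian K) {x : K} : orthProj E x = 0 ↔ x ∈ E.spaceᗮ :=
  starProjection_apply_eq_zero_iff _

theorem orthProj_mul_self (E : Grassmannian K) : orthProj E * orthProj E = orthProj E :=
  isIdempotentElem_starProjection _

theorem star_orthProj (E : Grassmannian K) : star (orthProj E) = orthProj E :=
  (isSelfAdjoint_starProjection E.space).star_eq

theorem coe_projectionOntoL_perp (E : Grassmannian K) (x : K) :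
    (E.perp.space.projectionOntoL E.space (orthPair E).2.symm x : K) = (1 - orthProj E) x := by
  have h : (E.space.projectionOntoL E.perp.space (orthPair E).2 x : K) +
    (E.perp.space.projectionOntoL E.space (orthPair E).2.symm x : K) = x :=
    projectionL_add_projectionL_eq_self (orthPair E).2 x
  exact eq_sub_of_add_eq' h

/-- The embedding of a tangent vector at `E` that is given in the chart `i`. -/
theorem extend_tangentCoordChange (i : ComplPair K) {E : Grassmannian K}
    (hi : IsTopCompl E.space i.1.2.space) (V : i.1.1.space →L[ℝ] i.1.2.space) :
    extend E (tangentCoordChange i (orthPair E) E V) =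
      (1 - orthProj E) * tangentOp i V * orthProj E := by
  ext x
  have h := tangentCoordChange_apply i (orthPair E) hi (orthPair E).2 V
    (E.space.orthogonalProjectionOnto x)
  dsimp only at h
  rw [graphMap_coord_self] at h
  have h' := congrArg (Subtype.val) h
  refine h'.trans ?_
  -- `E` is the origin of its own chart, so the correction term vanishes.
  have h0 := coord_self E
  rw [AddSubgroupClass.coe_sub, coe_projectionOntoL_perp, h0]
  change _ - (0 : K) = _
  rw [sub_zero]
  rfl

/-- The coordinates in the chart `i` of a tangent vector at `E`. -/
theorem tangentCoordChange_orthPair (i : ComplPair K) {E : Grassmannian K}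
    (hi : IsTopCompl E.space i.1.2.space) (V : E.space →L[ℝ] E.perp.space) :
    tangentCoordChange (orthPair E) i E V =
      (i.1.2.space.projectionOntoL i.1.1.space i.2.symm -
        coord i.1.1.space i.1.2.space E.space ∘L i.1.1.space.projectionOntoL i.1.2.space i.2) ∘L
      extend E V ∘L graphMap _ _ (coord i.1.1.space i.1.2.space E.space) := by
  ext y : 1
  exact tangentCoordChange_apply (orthPair E) i (orthPair E).2 hi V y

end Hilbert

end Grassmannian
-- Analyticity of operations on operators
section Analytic

variable {Z V₁ V₂ V₃ : Type*} [NormedAddCommGroup Z] [NormedSpace ℝ Z]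
  [NormedAddCommGroup V₁] [NormedSpace ℝ V₁] [NormedAddCommGroup V₂] [NormedSpace ℝ V₂]
  [NormedAddCommGroup V₃] [NormedSpace ℝ V₃]

theorem AnalyticAt.continuousLinearMap_comp {f : Z → V₂ →L[ℝ] V₃} {g : Z → V₁ →L[ℝ] V₂} {z : Z}
    (hf : AnalyticAt ℝ f z) (hg : AnalyticAt ℝ g z) :
    AnalyticAt ℝ (fun z => f z ∘L g z) z :=
  ((ContinuousLinearMap.compL ℝ V₁ V₂ V₃).analyticAt_bilinear (_, _)).comp_of_eq
    (hf.prod hg) rfl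

theorem AnalyticAt.continuousLinearMap_apply {f : Z → V₁ →L[ℝ] V₂} {g : Z → V₁} {z : Z}
    (hf : AnalyticAt ℝ f z) (hg : AnalyticAt ℝ g z) :
    AnalyticAt ℝ (fun z => f z (g z)) z :=
  ((ContinuousLinearMap.id ℝ (V₁ →L[ℝ] V₂)).analyticAt_bilinear (_, _)).comp_of_eq
    (hf.prod hg) rfl

theorem AnalyticAt.inner_real {H : Type*} [NormedAddCommGroup H] [InnerProductSpace ℝ H]
    {f g : Z → H} {z : Z} (hf : AnalyticAt ℝ f z) (hg : AnalyticAt ℝ g z) :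
    AnalyticAt ℝ (fun z => inner ℝ (f z) (g z)) z :=
  ((innerSL ℝ (E := H)).analyticAt_bilinear (_, _)).comp_of_eq (hf.prod hg) rfl

/-- Conjugation by `a`, as a bounded operator on `A`, is what the trivializations of the subbundle
are made of. -/
theorem analyticAt_mulLeftRight_inverse {A : Type*} [NormedRing A] [NormedAlgebra ℝ A]
    [CompleteSpace A] {a : A} (ha : IsUnit a) :
    AnalyticAt ℝ (fun a : A => ContinuousLinearMap.mulLeftRight ℝ A a (Ring.inverse a)) a := by
  have h : AnalyticAt ℝ (Ring.inverse : A → A) a := analyticAt_inverse ha.unit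
  have h1 : AnalyticAt ℝ (fun a : A => ContinuousLinearMap.mulLeftRight ℝ A a) a :=
    ContinuousLinearMap.analyticAt (𝕜 := ℝ) (E := A) (F := A →L[ℝ] A →L[ℝ] A)
      (ContinuousLinearMap.mulLeftRight ℝ A) a
  exact h1.continuousLinearMap_apply h

end Analytic

/-! ### Analytic maps between Banach manifolds -/

namespace AnalyticBanachManifold

variable {M N N' : Type u} [TopologicalSpace M] [AnalyticBanachManifold M]
  [TopologicalSpace N] [AnalyticBanachManifold N] [TopologicalSpace N'] [AnalyticBanachManifold N']
  {Y Z : Type u} [NormedAddCommGroup Y] [NormedSpace ℝ Y] [CompleteSpace Y]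
  [NormedAddCommGroup Z] [NormedSpace ℝ Z] [CompleteSpace Z]

theorem continuousAt_of_comp_chart_symm {W : Type*} [TopologicalSpace W] {f : M → W} {x : M}
    (i : Idx M) (hx : x ∈ (chart i).source)
    (h : ContinuousAt (fun y => f ((chart i).symm y)) (chart i x)) : ContinuousAt f x := by
  have h1 : ContinuousAt (fun x => f ((chart i).symm (chart i x))) x :=
    ContinuousAt.comp (f := chart i) h ((chart i).continuousAt hx)
  refine h1.congr ?_
  filter_upwards [(chart i).open_source.mem_nhds hx] with z hz
  rw [(chart i).left_inv hz]

theorem mapAnalyticAt_of_comp_chart_symm {f : M → Y} {x : M}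
    (h : AnalyticAt ℝ (fun y => f ((chart (idxAt x)).symm y)) (chart (idxAt x) x)) :
    MapAnalyticAt f x :=
  ⟨continuousAt_of_comp_chart_symm _ (mem_source x) h.continuousAt, h⟩

theorem MapAnalyticAt.prodMk {f : M → N} {g : M → N'} {x : M} (hf : MapAnalyticAt f x)
    (hg : MapAnalyticAt g x) : MapAnalyticAt (fun x => (f x, g x)) x :=
  ⟨hf.1.prodMk hg.1, hf.2.prod hg.2⟩

theorem MapAnalyticAt.analyticAt_comp {g : Y → Z} {f : M → Y} {x : M}
    (hf : MapAnalyticAt f x) (hg : AnalyticAt ℝ g (f x)) :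
    MapAnalyticAt (fun x => g (f x)) x := by
  refine mapAnalyticAt_of_comp_chart_symm ?_
  refine AnalyticAt.comp_of_eq hg hf.2 ?_
  exact congrArg f ((chart (idxAt x)).left_inv (mem_source x))

theorem MapAnalyticAt.congr_of_eventuallyEq {f g : M → Y} {x : M} (hf : MapAnalyticAt f x)
    (h : g =ᶠ[𝓝 x] f) : MapAnalyticAt g x := by
  refine mapAnalyticAt_of_comp_chart_symm (hf.2.congr ?_)
  have h1 := (chart (idxAt x)).symm.continuousAt ((chart (idxAt x)).map_source (mem_source x))
  rw [ContinuousAt, (chart (idxAt x)).left_inv (mem_source x)] at h1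
  exact (h1.eventually h).mono fun y hy => hy.symm

/-- By the chain rule the derivative of `r` is a continuous left inverse of the differential, which
is therefore injective with complemented range. -/
theorem differential_of_localRetract {f : M → N} {x : M} (hf : MapAnalyticAt f x)
    {r : Model (idxAt (f x)) → Model (idxAt x)}
    (hr : AnalyticAt ℝ r (localRep f x (chart (idxAt x) x)))
    (h : ∀ y, r (localRep f x y) = y) :
    Function.Injective (differential f x) ∧ (differential f x).range.ClosedComplemented := by
  have h1 : HasFDerivAt (localRep f x) (differential f x) (chart (idxAt x) x) :=
    hf.2.differentiableAt.hasFDerivAt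
  have h2 := HasFDerivAt.comp _ hr.differentiableAt.hasFDerivAt h1
  have h3 : r ∘ localRep f x = id := funext h
  rw [h3] at h2
  have h4 : Function.LeftInverse (fderiv ℝ r (localRep f x (chart (idxAt x) x)))
      (differential f x) := fun v => DFunLike.congr_fun (h2.unique (hasFDerivAt_id _)) v
  exact ⟨h4.injective, ContinuousLinearMap.closedComplemented_range_of_leftInverse _ _ h4⟩

theorem MapAnalyticAt.mulLeftRight_inverse {A : Type u} [NormedRing A] [NormedAlgebra ℝ A]
    [CompleteSpace A] {g : M → A} {x : M} (hg : MapAnalyticAt g x) (hu : IsUnit (g x)) :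
    MapAnalyticAt (fun x => ContinuousLinearMap.mulLeftRight ℝ A (g x) (Ring.inverse (g x))) x :=
  hg.analyticAt_comp (analyticAt_mulLeftRight_inverse hu)

theorem mapAnalyticAt_base (p : TangentTotal M) :
    MapAnalyticAt (TangentTotal.base : TangentTotal M → M) p := by
  constructor
  · refine continuousAt_of_comp_chart_symm (idxAt p) (mem_source p) ?_
    exact ContinuousAt.comp (g := (chart (idxAt p.base)).symm)
      (f := fun z : Model (idxAt p.base) × Model (idxAt p.base) => z.1)
      ((chart (idxAt p.base)).symm.continuousAt
        ((chart (idxAt p.base)).map_source (mem_source p.base))) continuousAt_fst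
  · refine AnalyticAt.congr (f := fun z : Model (idxAt p.base) × Model (idxAt p.base) => z.1)
      analyticAt_fst ?_
    have hopen : IsOpen ((chart (idxAt p.base)).target ×ˢ (univ : Set (Model (idxAt p.base)))) :=
      (chart (idxAt p.base)).open_target.prod isOpen_univ
    filter_upwards [hopen.mem_nhds ⟨(chart (idxAt p.base)).map_source (mem_source p.base),
      mem_univ _⟩] with z hz
    exact ((chart (idxAt p.base)).right_inv hz.1).symm

end AnalyticBanachManifold

/-! ### Analyticity of the orthogonal projection -/

namespace Grassmannian

open Submodule AnalyticBanachManifold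

variable {K : Type u} [NormedAddCommGroup K] [InnerProductSpace ℝ K] [CompleteSpace K]

/-- `Q - Q*` is skew-adjoint and contributes nothing to the quadratic form, so the operator is
coercive with constant `1`. -/
theorem isUnit_one_add_sub_star (Q : K →L[ℝ] K) : IsUnit (1 + Q - star Q) := by
  refine ContinuousLinearMap.isUnit_of_forall_le_norm_inner_map _ (c := 1) one_pos fun x => ?_
  have h : inner ℝ ((1 + Q - star Q) x) x = ‖x‖ ^ 2 := by
    change inner ℝ (x + Q x - (ContinuousLinearMap.adjoint Q) x) x = _
    rw [inner_sub_left, inner_add_left, ContinuousLinearMap.adjoint_inner_left,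
      real_inner_comm x (Q x), real_inner_self_eq_norm_sq, real_inner_comm]
    ring
  rw [h]
  simp

/-- With `P` the orthogonal projection, `P Q = Q` and `Q P = P`; the adjoint of the second identity
is `P Q* = P`. Together they give `P (1 + Q - Q*) = Q`. -/
theorem orthProj_eq_mul_inverse {E : Grassmannian K} {Q : K →L[ℝ] K} (hQ : ∀ x, Q x ∈ E.space)
    (hQ' : ∀ x ∈ E.space, Q x = x) :
    orthProj E = Q * Ring.inverse (1 + Q - star Q) := by
  have h1 : orthProj E * Q = Q := by
    ext x
    exact (orthProj_eq_self_iff E).2 (hQ x)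
  have h2 : Q * orthProj E = orthProj E := by
    ext x
    exact hQ' _ (orthProj_mem E x)
  have h3 : orthProj E * star Q = orthProj E := by
    have := congrArg star h2
    rwa [star_mul, star_orthProj] at this
  have h4 : orthProj E * (1 + Q - star Q) = Q := by
    rw [mul_sub, mul_add, h1, h3, mul_one]
    abel
  calc orthProj E = orthProj E * ((1 + Q - star Q) * Ring.inverse (1 + Q - star Q)) := by
        rw [Ring.mul_inverse_cancel _ (isUnit_one_add_sub_star Q), mul_one]
    _ = _ := by rw [← mul_assoc, h4]

/-- The orthogonal projection depends analytically on the subspace, in every chart. -/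
theorem analyticAt_orthProj_graph (i : ComplPair K) (T : i.1.1.space →L[ℝ] i.1.2.space) :
    AnalyticAt ℝ (fun T => orthProj (graph i.1.1 i.1.2 i.2 T)) T := by
  -- The oblique projection onto the graph of `T` along the second space of the chart. The identity
  -- factor brings it into the form of `analyticAt_graphMap`.
  set Q : (i.1.1.space →L[ℝ] i.1.2.space) → K →L[ℝ] K := fun T =>
    (ContinuousLinearMap.id ℝ K ∘L graphMap i.1.1.space i.1.2.space T) ∘L
      i.1.1.space.projectionOntoL i.1.2.space i.2
  have h : (fun T => orthProj (graph i.1.1 i.1.2 i.2 T)) =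
      fun T => Q T * Ring.inverse (1 + Q T - star (Q T)) := by
    funext T
    refine orthProj_eq_mul_inverse (fun x => ⟨_, rfl⟩) ?_
    rintro _ ⟨y, rfl⟩
    exact congrArg (graphMap i.1.1.space i.1.2.space T) (proj_graphMap i.2 T y)
  have hQ : AnalyticAt ℝ Q T :=
    (analyticAt_graphMap _ _ _ T).continuousLinearMap_comp analyticAt_const
  have hQs : AnalyticAt ℝ (fun T => star (Q T)) T :=
    ((starL' ℝ (A := K →L[ℝ] K)).toContinuousLinearMap.analyticAt _).comp_of_eq hQ rfl
  rw [h]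
  exact hQ.mul ((analyticAt_inverse (𝕜 := ℝ) (isUnit_one_add_sub_star (Q T)).unit).comp_of_eq
    ((analyticAt_const.add hQ).sub hQs) rfl)

theorem mapAnalyticAt_orthProj (E : Grassmannian K) :
    MapAnalyticAt (orthProj : Grassmannian K → K →L[ℝ] K) E :=
  mapAnalyticAt_of_comp_chart_symm (M := Grassmannian K) (analyticAt_orthProj_graph _ _)

/-! ### Tangent vectors as operators on `K`, in charts -/

omit [CompleteSpace K] in
theorem isTopCompl_graph_space (i : ComplPair K) (T : i.1.1.space →L[ℝ] i.1.2.space) :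
    IsTopCompl (graph i.1.1 i.1.2 i.2 T).space i.1.2.space := isTopCompl_graph i.2 T

/-- The operator on `K` given by the tangent vector with coordinates `(T, V)` in the chart `i`. -/
def chartExtend (i : ComplPair K) (T V : i.1.1.space →L[ℝ] i.1.2.space) : K →L[ℝ] K :=
  (1 - orthProj (graph i.1.1 i.1.2 i.2 T)) * tangentOp i V * orthProj (graph i.1.1 i.1.2 i.2 T)

theorem extend_tangentCoordChange_graph (i : ComplPair K)
    (T V : i.1.1.space →L[ℝ] i.1.2.space) :
    extend _ (tangentCoordChange i (orthPair (graph i.1.1 i.1.2 i.2 T))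
      (graph i.1.1 i.1.2 i.2 T) V) = chartExtend i T V :=
  extend_tangentCoordChange i (isTopCompl_graph_space i T) V

theorem analyticAt_chartExtend {Z : Type*} [NormedAddCommGroup Z] [NormedSpace ℝ Z]
    (i : ComplPair K) {T V : Z → i.1.1.space →L[ℝ] i.1.2.space} {z : Z}
    (hT : AnalyticAt ℝ T z) (hV : AnalyticAt ℝ V z) :
    AnalyticAt ℝ (fun z => chartExtend i (T z) (V z)) z := by
  have hP : AnalyticAt ℝ (fun z => orthProj (graph i.1.1 i.1.2 i.2 (T z))) z :=
    (analyticAt_orthProj_graph i (T z)).comp_of_eq hT rfl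
  have hD : AnalyticAt ℝ (fun z => tangentOp i (V z)) z :=
    AnalyticAt.comp_of_eq (g := tangentOp i) (ContinuousLinearMap.analyticAt (𝕜 := ℝ)
      (E := i.1.1.space →L[ℝ] i.1.2.space) (F := K →L[ℝ] K) (tangentOp i) (V z)) hV rfl
  exact ((analyticAt_const.sub hP).mul hD).mul hP

/-- The coordinates in the chart `i` of the tangent vector that is given by an operator on `K`. -/
def chartRestrict (i : ComplPair K) (T : i.1.1.space →L[ℝ] i.1.2.space) (S : K →L[ℝ] K) :
    i.1.1.space →L[ℝ] i.1.2.space :=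
  (i.1.2.space.projectionOntoL i.1.1.space i.2.symm -
    T ∘L i.1.1.space.projectionOntoL i.1.2.space i.2) ∘L S ∘L
      (ContinuousLinearMap.id ℝ K ∘L graphMap _ _ T)

omit [CompleteSpace K] in
theorem analyticAt_chartRestrict {Z : Type*} [NormedAddCommGroup Z] [NormedSpace ℝ Z]
    (i : ComplPair K) {T : Z → i.1.1.space →L[ℝ] i.1.2.space} {S : Z → K →L[ℝ] K} {z : Z}
    (hT : AnalyticAt ℝ T z) (hS : AnalyticAt ℝ S z) :
    AnalyticAt ℝ (fun z => chartRestrict i (T z) (S z)) z :=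
  (analyticAt_const.sub (hT.continuousLinearMap_comp analyticAt_const)).continuousLinearMap_comp
    (hS.continuousLinearMap_comp ((analyticAt_graphMap _ _ _ (T z)).comp_of_eq hT rfl))

theorem tangentCoordChange_eq_chartRestrict (i : ComplPair K) {E : Grassmannian K}
    (hi : IsTopCompl E.space i.1.2.space) (V : E.space →L[ℝ] E.perp.space) :
    tangentCoordChange (orthPair E) i E V =
      chartRestrict i (coord i.1.1.space i.1.2.space E.space) (extend E V) :=
  tangentCoordChange_orthPair i hi V

/-- The two maps express the coordinate changes from `i` to the orthogonal pair and back, so the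
cocycle identity applies. -/
theorem chartRestrict_chartExtend (i : ComplPair K) (T V : i.1.1.space →L[ℝ] i.1.2.space) :
    chartRestrict i T (chartExtend i T V) = V := by
  have h := tangentCoordChange_eq_chartRestrict i (isTopCompl_graph_space i T)
    (tangentCoordChange i (orthPair (graph i.1.1 i.1.2 i.2 T)) (graph i.1.1 i.1.2 i.2 T) V)
  rw [extend_tangentCoordChange_graph, coord_graph] at h
  rw [← h]
  have h1 : IsTopCompl (graph i.1.1 i.1.2 i.2 T).space i.1.2.space := isTopCompl_graph_space i T
  have h2 : IsTopCompl (graph i.1.1 i.1.2 i.2 T).space (graph i.1.1 i.1.2 i.2 T).perp.space :=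
    isTopCompl_orthogonal _
  exact (coordChange_coordChange (M := Grassmannian K) (i := i)
    (j := orthPair (graph i.1.1 i.1.2 i.2 T)) (k := i) h1 h2 h1 V).trans
      (coordChange_self (M := Grassmannian K) (i := i) h1 V)

/-! ### The embedding of the tangent bundle: image, immersion, homeomorphism -/

theorem extend_mem_fibre (E : Grassmannian K) (T : E.space →L[ℝ] E.spaceᗮ) :
    extend E T ∈ E.fibre := by
  constructor
  · intro x hx
    have : E.space.orthogonalProjectionOnto x = 0 := by
      rw [← Submodule.coe_eq_zero]
      exact (orthProj_eq_zero_iff E).2 hx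
    simp [extend, this]
  · intro x
    exact (T _).2

theorem isLinearMap_extend (E : Grassmannian K) :
    IsLinearMap ℝ (fun T : E.space →L[ℝ] E.spaceᗮ => extend E T) where
  map_add S T := by ext x; simp [extend]
  map_smul c T := by ext x; simp [extend]

theorem extend_apply_coe (E : Grassmannian K) (T : E.space →L[ℝ] E.spaceᗮ) (x : E.space) :
    extend E T x = T x := by
  simp [extend]

theorem extend_injective (E : Grassmannian K) :
    Function.Injective (fun T : E.space →L[ℝ] E.spaceᗮ => extend E T) := by
  intro S T h
  ext x
  rw [← extend_apply_coe, ← extend_apply_coe]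
  exact DFunLike.congr_fun h (x : K)

/-- In this algebraic form the fibre can be transported by conjugation. -/
theorem mem_fibre_iff {E : Grassmannian K} {S : K →L[ℝ] K} :
    S ∈ E.fibre ↔ orthProj E * S = 0 ∧ S * (1 - orthProj E) = 0 := by
  constructor
  · rintro ⟨h1, h2⟩
    constructor <;> ext x
    · exact (orthProj_eq_zero_iff E).2 (h2 x)
    · exact h1 _ (sub_starProjection_mem_orthogonal x)
  · rintro ⟨h1, h2⟩
    constructor
    · intro x hx
      have h3 : S (x - orthProj E x) = 0 := DFunLike.congr_fun h2 x
      rwa [(orthProj_eq_zero_iff E).2 hx, sub_zero] at h3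
    · intro x
      exact (orthProj_eq_zero_iff E).1 (DFunLike.congr_fun h1 x)

theorem range_tangentEmbedding :
    range (tangentEmbedding K) = {p | p.2 ∈ fibre p.1} := by
  ext ⟨E, S⟩
  constructor
  · rintro ⟨p, hp⟩
    obtain rfl : p.base = E := congrArg Prod.fst hp
    obtain rfl : extend p.base p.vec = S := congrArg Prod.snd hp
    exact extend_mem_fibre _ _
  · rintro ⟨h1, h2⟩
    -- The preimage is the restriction of `S` to `E`; it recovers `S` because `S` kills `x - P x`.
    refine ⟨⟨E, (S ∘L E.space.subtypeL).codRestrict E.spaceᗮ fun x => h2 x⟩, ?_⟩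
    refine Prod.ext rfl ?_
    ext x
    change S (orthProj E x) = S x
    have h3 : S (x - orthProj E x) = 0 := h1 _ (sub_starProjection_mem_orthogonal x)
    rw [map_sub, sub_eq_zero] at h3
    exact h3.symm

theorem tangentEmbedding_injective : Function.Injective (tangentEmbedding K) := by
  rintro ⟨E, S⟩ ⟨E', T⟩ h
  obtain rfl : E = E' := congrArg Prod.fst h
  have h2 : extend E S = extend E T := congrArg Prod.snd h
  rw [extend_injective E h2]

theorem mapAnalyticAt_tangentEmbedding (p : TangentTotal (Grassmannian K)) :
    MapAnalyticAt (tangentEmbedding K) p := by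
  refine (mapAnalyticAt_base p).prodMk (mapAnalyticAt_of_comp_chart_symm ?_)
  have h := analyticAt_chartExtend (orthPair p.base)
    (T := Prod.fst) (V := Prod.snd) (z := chart (idxAt p) p) analyticAt_fst analyticAt_snd
  refine h.congr (Filter.Eventually.of_forall fun z => ?_)
  exact (extend_tangentCoordChange_graph (orthPair p.base) z.1 z.2).symm

/-- A left inverse of the embedding of the tangent bundle, in the chart `i`. -/
def chartRetract (i : ComplPair K)
    (z : (i.1.1.space →L[ℝ] i.1.2.space) × (K →L[ℝ] K)) :
    (i.1.1.space →L[ℝ] i.1.2.space) × (i.1.1.space →L[ℝ] i.1.2.space) :=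
  (z.1, chartRestrict i z.1 z.2)

omit [CompleteSpace K] in
theorem analyticAt_chartRetract (i : ComplPair K)
    (z : (i.1.1.space →L[ℝ] i.1.2.space) × (K →L[ℝ] K)) :
    AnalyticAt ℝ (chartRetract i) z :=
  analyticAt_fst.prod (analyticAt_chartRestrict i analyticAt_fst analyticAt_snd)

/-- The charts of the Grassmannian are onto, so the identity holds for every `z`, as
`differential_of_localRetract` requires. -/
theorem chartRetract_localRep (p : TangentTotal (Grassmannian K))
    (z : (p.base.space →L[ℝ] p.base.perp.space) × (p.base.space →L[ℝ] p.base.perp.space)) :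
    chartRetract (orthPair p.base) (localRep (tangentEmbedding K) p z) = z := by
  have h : localRep (tangentEmbedding K) p z =
      (z.1, chartExtend (orthPair p.base) z.1 z.2) :=
    Prod.ext (coord_graph (orthPair p.base) z.1)
      (extend_tangentCoordChange_graph (orthPair p.base) z.1 z.2)
  rw [h]
  exact Prod.ext rfl (chartRestrict_chartExtend (orthPair p.base) z.1 z.2)

theorem isAnalyticImmersion_tangentEmbedding : IsAnalyticImmersion (tangentEmbedding K) := by
  intro p
  have ha := mapAnalyticAt_tangentEmbedding p
  exact ⟨ha, differential_of_localRetract ha (r := chartRetract (orthPair p.base))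
    (analyticAt_chartRetract (orthPair p.base) _) (chartRetract_localRep p)⟩

theorem isEmbedding_tangentEmbedding : IsEmbedding (tangentEmbedding K) := by
  refine ⟨isInducing_iff_nhds.2 fun p => le_antisymm ?_ ?_, tangentEmbedding_injective⟩
  · exact (mapAnalyticAt_tangentEmbedding p).1.tendsto.le_comap
  · set i := orthPair p.base
    let φ := chart (M := Grassmannian K) i
    let ψ := chart (M := TangentTotal (Grassmannian K)) i
    have hφ : p.base ∈ φ.source := mem_source p.base
    have hψ : p ∈ ψ.source := mem_source p
    have hr : ∀ q : TangentTotal (Grassmannian K), q.base ∈ φ.source →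
        chartRetract i (φ (tangentEmbedding K q).1, (tangentEmbedding K q).2) = ψ q := fun q hq =>
      Prod.ext rfl (tangentCoordChange_eq_chartRestrict i hq q.vec).symm
    -- A left inverse of the embedding over the domain of `φ`, continuous at the image of `p`.
    -- Whether a point lies over this domain is visible from the first component of its image.
    let h : Grassmannian K × (K →L[ℝ] K) → TangentTotal (Grassmannian K) := fun q =>
      ψ.symm (chartRetract i (φ q.1, q.2))
    have hh : ∀ q : TangentTotal (Grassmannian K), q.base ∈ φ.source →
        h (tangentEmbedding K q) = q := fun q hq => by
      change ψ.symm (chartRetract i (φ (tangentEmbedding K q).1, (tangentEmbedding K q).2)) = q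
      rw [hr q hq]
      exact ψ.left_inv hq
    have h1 : ContinuousAt (fun q : Grassmannian K × (K →L[ℝ] K) => (φ q.1, q.2))
        (tangentEmbedding K p) :=
      (ContinuousAt.comp (f := Prod.fst) (φ.continuousAt hφ) continuousAt_fst).prodMk
        continuousAt_snd
    have h2 : ContinuousAt (fun q : Grassmannian K × (K →L[ℝ] K) =>
        chartRetract i (φ q.1, q.2)) (tangentEmbedding K p) :=
      ContinuousAt.comp (g := chartRetract i) (analyticAt_chartRetract i _).continuousAt h1
    have h3 : ContinuousAt h (tangentEmbedding K p) := by
      refine ContinuousAt.comp (g := ψ.symm) ?_ h2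
      rw [hr p hφ]
      exact ψ.symm.continuousAt (ψ.map_source hψ)
    have h4 : Filter.Tendsto h (𝓝 (tangentEmbedding K p)) (𝓝 p) := by
      have := h3.tendsto
      rwa [hh p hφ] at this
    have h5 : ∀ᶠ q in Filter.comap (tangentEmbedding K) (𝓝 (tangentEmbedding K p)),
        h (tangentEmbedding K q) = q := by
      have h6 : ∀ᶠ q : Grassmannian K × (K →L[ℝ] K) in 𝓝 (tangentEmbedding K p),
          q.1 ∈ φ.source :=
        continuousAt_fst.eventually (φ.open_source.mem_nhds hφ)
      filter_upwards [h6.comap (tangentEmbedding K)] with q hq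
      exact hh q hq
    exact (h4.comp Filter.tendsto_comap).congr' h5

/-! ### The subbundle -/

/-- The map `S ↦ (1 - P) S P` is a continuous projection onto the fibre. -/
theorem fibre_closedComplemented (E : Grassmannian K) : (E.fibre).ClosedComplemented := by
  have hmem : ∀ S : K →L[ℝ] K,
      ContinuousLinearMap.mulLeftRight ℝ (K →L[ℝ] K) (1 - orthProj E) (orthProj E) S ∈
        E.fibre := by
    intro S
    have h := orthProj_mul_self E
    rw [mem_fibre_iff, ContinuousLinearMap.mulLeftRight_apply]
    constructor
    · rw [← mul_assoc, ← mul_assoc, mul_sub, mul_one, h, sub_self, zero_mul, zero_mul]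
    · rw [mul_assoc, mul_sub, mul_one, h, sub_self, mul_zero]
  refine ⟨(ContinuousLinearMap.mulLeftRight ℝ (K →L[ℝ] K) (1 - orthProj E)
    (orthProj E)).codRestrict _ hmem, fun S => ?_⟩
  obtain ⟨h1, h2⟩ := mem_fibre_iff.1 S.2
  ext1
  rw [mul_sub, mul_one, sub_eq_zero] at h2
  change (1 - orthProj E) * (S : K →L[ℝ] K) * orthProj E = S
  rw [sub_mul, one_mul, h1, sub_zero, ← h2]

/-- For `E` close to `E₀`, this is an automorphism of `K` that sends `E₀` to `E` and the
orthogonal complement of `E₀` to that of `E`. -/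
def intertwiner (E₀ E : Grassmannian K) : K →L[ℝ] K :=
  orthProj E * orthProj E₀ + (1 - orthProj E) * (1 - orthProj E₀)

/-- Both sides equal `P P₀`, since the remaining terms contain `P (1 - P)` or `(1 - P₀) P₀`. -/
theorem orthProj_mul_intertwiner (E₀ E : Grassmannian K) :
    orthProj E * intertwiner E₀ E = intertwiner E₀ E * orthProj E₀ := by
  have h := orthProj_mul_self E
  have h0 := orthProj_mul_self E₀
  rw [intertwiner, mul_add, add_mul, ← mul_assoc, ← mul_assoc, h, mul_assoc _ _ (orthProj E₀),
    h0, mul_assoc _ _ (orthProj E₀), sub_mul 1 (orthProj E₀), h0, mul_sub (orthProj E) 1, h]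
  simp

theorem intertwiner_self (E : Grassmannian K) : intertwiner E E = 1 := by
  have h := orthProj_mul_self E
  rw [intertwiner, mul_sub, sub_mul (1 : K →L[ℝ] K) _ (orthProj E), h]
  simp

theorem mapAnalyticAt_intertwiner (E₀ E : Grassmannian K) :
    MapAnalyticAt (intertwiner E₀) E := by
  refine MapAnalyticAt.analyticAt_comp
    (g := fun P : K →L[ℝ] K => P * orthProj E₀ + (1 - P) * (1 - orthProj E₀))
    (mapAnalyticAt_orthProj E) ?_
  exact (analyticAt_id.mul analyticAt_const).add
    ((analyticAt_const.sub analyticAt_id).mul analyticAt_const)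

/-- Conjugation by a unit, as an automorphism of a normed algebra. -/
def conjEquiv {A : Type*} [NormedRing A] [NormedAlgebra ℝ A] (g : Aˣ) : A ≃L[ℝ] A :=
  ContinuousLinearEquiv.equivOfInverse
    (ContinuousLinearMap.mulLeftRight ℝ A g ((g⁻¹ : Aˣ) : A))
    (ContinuousLinearMap.mulLeftRight ℝ A ((g⁻¹ : Aˣ) : A) g)
    (fun x => by simp [mul_assoc]) (fun x => by simp [mul_assoc])

theorem conjEquiv_apply {A : Type*} [NormedRing A] [NormedAlgebra ℝ A] (g : Aˣ) (x : A) :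
    conjEquiv g x = g * x * ((g⁻¹ : Aˣ) : A) := rfl

open Classical in
/-- The trivialization near `E₀` of the bundle of operators `E → Eᗮ`. -/
def fibreTrivialization (E₀ E : Grassmannian K) : (K →L[ℝ] K) ≃L[ℝ] (K →L[ℝ] K) :=
  if h : IsUnit (intertwiner E₀ E) then conjEquiv h.unit else ContinuousLinearEquiv.refl ℝ _

/-- From `P g = g P₀` one gets `P (g S g⁻¹) = g (P₀ S) g⁻¹`, and similarly on the right with the
complementary projections. Units can be cancelled. -/
theorem fibreTrivialization_mem_iff {E₀ E : Grassmannian K} (h : IsUnit (intertwiner E₀ E))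
    (S : K →L[ℝ] K) : fibreTrivialization E₀ E S ∈ E.fibre ↔ S ∈ E₀.fibre := by
  obtain ⟨g, hg⟩ := h
  have h1 : fibreTrivialization E₀ E S = g * S * ((g⁻¹ : (K →L[ℝ] K)ˣ) : K →L[ℝ] K) := by
    rw [fibreTrivialization, dif_pos ⟨g, hg⟩, conjEquiv_apply]
    have : IsUnit.unit ⟨g, hg⟩ = g := Units.ext hg.symm
    rw [this]
  have hP : orthProj E * g = g * orthProj E₀ := by
    rw [hg, orthProj_mul_intertwiner]
  have hP' : ((g⁻¹ : (K →L[ℝ] K)ˣ) : K →L[ℝ] K) * (1 - orthProj E) =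
      (1 - orthProj E₀) * ((g⁻¹ : (K →L[ℝ] K)ˣ) : K →L[ℝ] K) := by
    rw [Units.inv_mul_eq_iff_eq_mul, ← mul_assoc, Units.eq_mul_inv_iff_mul_eq, sub_mul, mul_sub,
      hP, one_mul, mul_one]
  rw [mem_fibre_iff, mem_fibre_iff, h1]
  refine and_congr ?_ ?_
  · rw [← mul_assoc, ← mul_assoc, hP, Units.mul_left_eq_zero, mul_assoc, Units.mul_right_eq_zero]
  · rw [mul_assoc, hP', ← mul_assoc, Units.mul_left_eq_zero, mul_assoc, Units.mul_right_eq_zero]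

theorem isAnalyticSubbundle_fibre :
    IsAnalyticSubbundle (fun E : Grassmannian K => E.fibre) := by
  intro E₀
  have hcont : Continuous (intertwiner E₀) :=
    continuous_iff_continuousAt.2 fun E => (mapAnalyticAt_intertwiner E₀ E).1
  have hopen : IsOpen {E | IsUnit (intertwiner E₀ E)} := Units.isOpen.preimage hcont
  refine ⟨fibre_closedComplemented E₀, {E | IsUnit (intertwiner E₀ E)}, hopen, ?_,
    fibreTrivialization E₀, fun E hE => ?_, fun E hE S => fibreTrivialization_mem_iff hE S⟩
  · change IsUnit (intertwiner E₀ E₀)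
    rw [intertwiner_self]
    exact isUnit_one
  · refine ((mapAnalyticAt_intertwiner E₀ E).mulLeftRight_inverse hE).congr_of_eventuallyEq ?_
    -- Invertibility is an open condition, so the default value of `fibreTrivialization` does not
    -- occur near `E`.
    filter_upwards [hopen.mem_nhds hE] with E' hE'
    ext1 S
    have hu : IsUnit (intertwiner E₀ E') := hE'
    change fibreTrivialization E₀ E' S = _ * S * _
    rw [fibreTrivialization, dif_pos hu, conjEquiv_apply, ← Ring.inverse_unit]
    rfl

/-! ### The pseudo-metrics given by the vectors -/

theorem adjoint_extend (E : Grassmannian K) (T : E.space →L[ℝ] E.spaceᗮ) :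
    ContinuousLinearMap.adjoint (extend E T) = adjointExtend E T := by
  rw [extend, adjointExtend, ContinuousLinearMap.adjoint_comp, ContinuousLinearMap.adjoint_comp,
    Submodule.adjoint_subtypeL, Submodule.adjoint_orthogonalProjectionOnto]
  rfl

theorem opMetric_eq (E : Grassmannian K) (S T : E.space →L[ℝ] E.spaceᗮ) :
    opMetric E S T = ContinuousLinearMap.adjoint (extend E S) ∘L extend E T := by
  rw [opMetric, ← adjoint_extend, ← adjoint_extend, ContinuousLinearMap.adjoint_adjoint]

/-- Moving the adjoint across exhibits the form as the pullback of the inner product of `K` under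
evaluation at `x`, which makes symmetry and positivity evident. -/
theorem vecMetric_eq_inner (x : K) (E : Grassmannian K) (S T : E.space →L[ℝ] E.spaceᗮ) :
    vecMetric x E S T = inner ℝ (extend E S x) (extend E T x) := by
  change inner ℝ (opMetric E S T x) x = _
  rw [opMetric_eq, ContinuousLinearMap.comp_apply, ContinuousLinearMap.adjoint_inner_left,
    real_inner_comm]

theorem vecMetric_coordChange (x : K) (i : ComplPair K) (T V W : i.1.1.space →L[ℝ] i.1.2.space) :
    vecMetric x (graph i.1.1 i.1.2 i.2 T)
      (tangentCoordChange i (orthPair (graph i.1.1 i.1.2 i.2 T)) (graph i.1.1 i.1.2 i.2 T) V)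
      (tangentCoordChange i (orthPair (graph i.1.1 i.1.2 i.2 T)) (graph i.1.1 i.1.2 i.2 T) W) =
      inner ℝ (chartExtend i T V x) (chartExtend i T W x) :=
  (vecMetric_eq_inner x _ _ _).trans <|
    congrArg₂ (fun A B : K →L[ℝ] K => inner ℝ (A x) (B x))
      (extend_tangentCoordChange_graph i T V) (extend_tangentCoordChange_graph i T W)

theorem isAnalyticPseudoMetricOn_vecMetric (x : K) :
    IsAnalyticPseudoMetricOn univ (vecMetric x) where
  linear_left E _ T := by
    have h := isLinearMap_extend E
    have hv := vecMetric_eq_inner x E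
    constructor
    · intro S S'
      rw [hv S T, hv S' T, ← inner_add_left]
      exact (hv _ T).trans (congrArg (fun A : K →L[ℝ] K => inner ℝ (A x) (extend E T x))
        (h.map_add S S'))
    · intro c S
      rw [hv S T, smul_eq_mul, ← real_inner_smul_left]
      exact (hv _ T).trans (congrArg (fun A : K →L[ℝ] K => inner ℝ (A x) (extend E T x))
        (h.map_smul c S))
  symm E _ S T := by
    have hv := vecMetric_eq_inner x E
    rw [hv S T, hv T S]
    exact real_inner_comm _ _
  nonneg E _ S := by
    rw [vecMetric_eq_inner x E S S]
    exact real_inner_self_nonneg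
  analytic := by
    intro i z _
    have h1 := analyticAt_chartExtend i (T := fun z : _ × _ × _ => z.1) (V := fun z => z.2.1)
      (z := z) analyticAt_fst (analyticAt_fst.comp analyticAt_snd)
    have h2 := analyticAt_chartExtend i (T := fun z : _ × _ × _ => z.1) (V := fun z => z.2.2)
      (z := z) analyticAt_fst (analyticAt_snd.comp analyticAt_snd)
    have h3 := (h1.continuousLinearMap_apply (analyticAt_const (v := x))).inner_real
      (h2.continuousLinearMap_apply (analyticAt_const (v := x)))
    refine h3.congr (Filter.Eventually.of_forall fun z => ?_)
    exact (vecMetric_coordChange x i z.1 z.2.1 z.2.2).symm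

theorem eq_zero_of_extend_eq_zero {E : Grassmannian K} {T : E.space →L[ℝ] E.spaceᗮ}
    (h : extend E T = 0) : T = 0 :=
  extend_injective E (h.trans (isLinearMap_extend E).map_zero.symm)

/-- The forms at `x a` give the squared norms of `extend E T (x a)`, and a bounded operator that
vanishes on a dense set is zero. -/
theorem isSeparating_of_denseRange {ι : Type*} {x : ι → K} (hx : DenseRange x) :
    IsSeparating (fun a => vecMetric (x a)) := by
  intro E T hT
  refine eq_zero_of_extend_eq_zero (E := E) (T := T) (ContinuousLinearMap.ext fun y => ?_)
  refine congrFun (DenseRange.equalizer (f := x) (g := extend E T) (h := fun _ => 0) hx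
    (extend E T).continuous continuous_const (funext fun a => ?_)) y
  exact inner_self_eq_zero.1 ((vecMetric_eq_inner (x a) E T T).symm.trans (hT a))

/-! ### The trace metric -/

-- Cyclicity `Tr (u v) = Tr (v u)` is used twice, since `finRankTrace` lives on the range of `u v`:
-- first to pass to the range of `u`, then to `W`.
omit [CompleteSpace K] in
theorem finRankTrace_comp {W : Type*} [NormedAddCommGroup W] [NormedSpace ℝ W]
    [FiniteDimensional ℝ W] (u : W →L[ℝ] K) (v : K →L[ℝ] W) :
    finRankTrace (u ∘L v) = LinearMap.trace ℝ W (v ∘L u).toLinearMap := by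
  set U : Submodule ℝ K := u.toLinearMap.range
  have hle : (u ∘L v).range ≤ U := by
    rintro _ ⟨x, rfl⟩
    exact ⟨v x, rfl⟩
  have : FiniteDimensional ℝ (u ∘L v).range := Submodule.finiteDimensional_of_le hle
  let u' : W →ₗ[ℝ] U := u.toLinearMap.rangeRestrict
  let v' : U →ₗ[ℝ] W := v.toLinearMap ∘ₗ U.subtype
  let j : (u ∘L v).range →ₗ[ℝ] U := Submodule.inclusion hle
  let r : U →ₗ[ℝ] (u ∘L v).range := (u ∘L v).toLinearMap.rangeRestrict ∘ₗ U.subtype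
  have h1 : finRankTrace (u ∘L v) = LinearMap.trace ℝ _ (r ∘ₗ j) := rfl
  have h2 : j ∘ₗ r = u' ∘ₗ v' := rfl
  rw [h1, LinearMap.trace_comp_comm', h2, LinearMap.trace_comp_comm']
  rfl

/-- The operator metric is `D* (C* T P)`, and cyclicity moves its trace to `W`. The freedom in `W`
matters: `W = E` yields the Hilbert–Schmidt formula, while the first space of a chart provides a
basis that stays fixed as `E` moves. -/
theorem traceMetric_eq_sum {ι W : Type*} [Fintype ι] [NormedAddCommGroup W]
    [InnerProductSpace ℝ W] [CompleteSpace W] (b : OrthonormalBasis ι ℝ W) {E : Grassmannian K}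
    {S : E.space →L[ℝ] E.spaceᗮ} {C : W →L[ℝ] K} {D : K →L[ℝ] W} (hS : extend E S = C ∘L D)
    (T : E.space →L[ℝ] E.spaceᗮ) :
    traceMetric E S T =
      ∑ k, inner ℝ (C (b k)) (extend E T (ContinuousLinearMap.adjoint D (b k))) := by
  have : FiniteDimensional ℝ W := b.toBasis.finiteDimensional_of_finite
  change finRankTrace (opMetric E S T) = _
  rw [opMetric_eq, hS, ContinuousLinearMap.adjoint_comp, ContinuousLinearMap.comp_assoc,
    finRankTrace_comp, LinearMap.trace_eq_sum_inner _ b]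
  refine Finset.sum_congr rfl fun k _ => ?_
  exact ContinuousLinearMap.adjoint_inner_right C (b k) _

theorem traceMetric_eq_sum_inner {ι : Type*} [Fintype ι] {E : Grassmannian K}
    (b : OrthonormalBasis ι ℝ E.space) (S T : E.space →L[ℝ] E.spaceᗮ) :
    traceMetric E S T = ∑ k, inner ℝ (S (b k)) (T (b k)) := by
  have hS : extend E S = (E.spaceᗮ.subtypeL ∘L S) ∘L E.space.orthogonalProjectionOnto := rfl
  rw [traceMetric_eq_sum b hS]
  refine Finset.sum_congr rfl fun k _ => ?_
  rw [Submodule.adjoint_orthogonalProjectionOnto]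
  change inner ℝ (S (b k) : K) (extend E T (b k : K)) = _
  rw [extend_apply_coe]
  rfl

theorem traceMetric_coordChange {ι : Type*} [Fintype ι] (i : ComplPair K)
    (b : OrthonormalBasis ι ℝ i.1.1.space) (T V W : i.1.1.space →L[ℝ] i.1.2.space) :
    traceMetric (graph i.1.1 i.1.2 i.2 T)
      (tangentCoordChange i (orthPair (graph i.1.1 i.1.2 i.2 T)) (graph i.1.1 i.1.2 i.2 T) V)
      (tangentCoordChange i (orthPair (graph i.1.1 i.1.2 i.2 T)) (graph i.1.1 i.1.2 i.2 T) W) =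
      ∑ k, inner ℝ ((1 - orthProj (graph i.1.1 i.1.2 i.2 T)) (V (b k) : K))
        (chartExtend i T W (orthProj (graph i.1.1 i.1.2 i.2 T)
          (ContinuousLinearMap.adjoint (i.1.1.space.projectionOntoL i.1.2.space i.2) (b k)))) := by
  -- Factorization of the extended tangent vector through the first space of the chart.
  have hS : extend _ (tangentCoordChange i (orthPair (graph i.1.1 i.1.2 i.2 T))
      (graph i.1.1 i.1.2 i.2 T) V) =
      ((1 - orthProj (graph i.1.1 i.1.2 i.2 T)) ∘L i.1.2.space.subtypeL ∘L V) ∘L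
        (i.1.1.space.projectionOntoL i.1.2.space i.2 ∘L orthProj (graph i.1.1 i.1.2 i.2 T)) := by
    rw [extend_tangentCoordChange_graph]
    rfl
  have hP := star_orthProj (graph i.1.1 i.1.2 i.2 T)
  rw [ContinuousLinearMap.star_eq_adjoint] at hP
  refine (traceMetric_eq_sum b hS _).trans (Finset.sum_congr rfl fun k _ => ?_)
  rw [ContinuousLinearMap.adjoint_comp, hP]
  exact congrArg (fun A : K →L[ℝ] K => inner ℝ _ (A _)) (extend_tangentCoordChange_graph i T W)

omit [CompleteSpace K] in
theorem finiteDimensional_graph_iff (i : ComplPair K) (T : i.1.1.space →L[ℝ] i.1.2.space) :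
    FiniteDimensional ℝ (graph i.1.1 i.1.2 i.2 T).space ↔ FiniteDimensional ℝ i.1.1.space := by
  constructor
  · intro h
    have hinj : Function.Injective (graphMap i.1.1.space i.1.2.space T) :=
      Function.LeftInverse.injective (proj_graphMap i.2 T)
    have : FiniteDimensional ℝ (graphMap i.1.1.space i.1.2.space T).toLinearMap.range := h
    exact FiniteDimensional.of_injective
      (graphMap i.1.1.space i.1.2.space T).toLinearMap.rangeRestrict
      fun x y hxy => hinj (congrArg Subtype.val hxy)
  · intro h
    exact inferInstanceAs
      (FiniteDimensional ℝ (graphMap i.1.1.space i.1.2.space T).toLinearMap.range)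

theorem isOpen_finPart : IsOpen (finPart K) := by
  change ∀ i : ComplPair K, IsOpen ((grChart i).target ∩ (grChart i).symm ⁻¹' finPart K)
  intro i
  -- `I + T` is injective, so all graphs in a chart have the dimension of its first space: the
  -- preimage is everything or empty.
  have h : (grChart i).target ∩ (grChart i).symm ⁻¹' finPart K =
      {_T | FiniteDimensional ℝ i.1.1.space} := by
    ext T
    exact (and_iff_right (mem_univ T)).trans (finiteDimensional_graph_iff i T)
  rw [h]
  exact isOpen_const

theorem finiteDimensional_range_opMetric {E : Grassmannian K} (hE : E ∈ finPart K)
    (S T : E.space →L[ℝ] E.spaceᗮ) : FiniteDimensional ℝ (opMetric E S T).range := by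
  have : FiniteDimensional ℝ E.space := hE
  refine Submodule.finiteDimensional_of_le (S₂ := E.space) ?_
  rintro _ ⟨x, rfl⟩
  exact Subtype.prop (p := fun x : K => x ∈ E.space) _

/-- The operator norm is at most the Hilbert–Schmidt norm: expand `v` in the basis and apply
Cauchy–Schwarz. Hence the lower bound of the trace metric holds with constant `1`. -/
theorem sq_norm_le_sum {ι V W : Type*} [Fintype ι] [NormedAddCommGroup V]
    [InnerProductSpace ℝ V] [NormedAddCommGroup W] [InnerProductSpace ℝ W]
    (b : OrthonormalBasis ι ℝ V) (S : V →L[ℝ] W) : ‖S‖ ^ 2 ≤ ∑ k, inner ℝ (S (b k)) (S (b k)) := by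
  have hs : 0 ≤ ∑ k, inner ℝ (S (b k)) (S (b k)) :=
    Finset.sum_nonneg fun k _ => real_inner_self_nonneg
  have h : ‖S‖ ≤ √(∑ k, inner ℝ (S (b k)) (S (b k))) := by
    refine S.opNorm_le_bound (Real.sqrt_nonneg _) fun v => ?_
    have h1 : ‖S v‖ ≤ ∑ k, ‖S (b k)‖ * ‖inner ℝ (b k) v‖ := by
      conv_lhs => rw [← b.sum_repr' v, map_sum]
      refine (norm_sum_le _ _).trans (Finset.sum_le_sum fun k _ => ?_)
      rw [map_smul, norm_smul, mul_comm]
    refine h1.trans ((Real.sum_mul_le_sqrt_mul_sqrt _ _ _).trans_eq ?_)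
    rw [b.sum_sq_norm_inner_right, Real.sqrt_sq (norm_nonneg v)]
    simp only [real_inner_self_eq_norm_sq]
  exact (pow_le_pow_left₀ (norm_nonneg _) h 2).trans_eq (Real.sq_sqrt hs)

theorem isAnalyticPseudoMetricOn_traceMetric :
    IsAnalyticPseudoMetricOn (finPart K) traceMetric where
  linear_left E hE T := by
    have : FiniteDimensional ℝ E.space := hE
    have h := traceMetric_eq_sum_inner (stdOrthonormalBasis ℝ E.space)
    constructor
    · intro S S'
      rw [h S T, h S' T, ← Finset.sum_add_distrib]
      refine (h _ T).trans (Finset.sum_congr rfl fun k _ => ?_)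
      exact inner_add_left _ _ _
    · intro c S
      rw [h S T, smul_eq_mul, Finset.mul_sum]
      refine (h _ T).trans (Finset.sum_congr rfl fun k _ => ?_)
      exact real_inner_smul_left _ _ _
  symm E hE S T := by
    have : FiniteDimensional ℝ E.space := hE
    have h := traceMetric_eq_sum_inner (stdOrthonormalBasis ℝ E.space)
    rw [h S T, h T S]
    exact Finset.sum_congr rfl fun k _ => real_inner_comm _ _
  nonneg E hE S := by
    have : FiniteDimensional ℝ E.space := hE
    rw [traceMetric_eq_sum_inner (stdOrthonormalBasis ℝ E.space) S S]
    exact Finset.sum_nonneg fun k _ => real_inner_self_nonneg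
  analytic := by
    intro (i : ComplPair K) z hz
    have : FiniteDimensional ℝ i.1.1.space := (finiteDimensional_graph_iff i z.1).1 hz.1.2
    -- The basis depends on the chart only, so the trace is a finite sum whose terms are analytic in
    -- the point and both vectors.
    let b := stdOrthonormalBasis ℝ i.1.1.space
    have hP : AnalyticAt ℝ (fun z : (i.1.1.space →L[ℝ] i.1.2.space) × (_ × _) =>
        orthProj (graph i.1.1 i.1.2 i.2 z.1)) z :=
      (analyticAt_orthProj_graph i z.1).comp_of_eq analyticAt_fst rfl
    have h2 := analyticAt_chartExtend i (T := fun z : _ × _ × _ => z.1) (V := fun z => z.2.2)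
      (z := z) analyticAt_fst (analyticAt_snd.comp analyticAt_snd)
    have h1 : ∀ k, AnalyticAt ℝ (fun z : (i.1.1.space →L[ℝ] i.1.2.space) ×
        ((i.1.1.space →L[ℝ] i.1.2.space) × (i.1.1.space →L[ℝ] i.1.2.space)) =>
        i.1.2.space.subtypeL (z.2.1 (b k))) z := fun k =>
      (analyticAt_const (v := i.1.2.space.subtypeL)).continuousLinearMap_apply
        ((analyticAt_fst.comp analyticAt_snd).continuousLinearMap_apply analyticAt_const)
    have h3 := Finset.univ.analyticAt_fun_sum fun k _ =>
      (((analyticAt_const (v := 1)).sub hP).continuousLinearMap_apply (h1 k)).inner_real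
        (h2.continuousLinearMap_apply (hP.continuousLinearMap_apply (analyticAt_const
          (v := ContinuousLinearMap.adjoint
            (i.1.1.space.projectionOntoL i.1.2.space i.2) (b k)))))
    refine h3.congr (Filter.Eventually.of_forall fun z => ?_)
    exact (traceMetric_coordChange i b z.1 z.2.1 z.2.2).symm

theorem sq_norm_le_traceMetric {E : Grassmannian K} (hE : E ∈ finPart K)
    (S : E.space →L[ℝ] E.spaceᗮ) : ‖S‖ ^ 2 ≤ traceMetric E S S := by
  have : FiniteDimensional ℝ E.space := hE
  rw [traceMetric_eq_sum_inner (stdOrthonormalBasis ℝ E.space) S S]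
  exact sq_norm_le_sum _ S

theorem isAnalyticMetricOn_traceMetric : IsAnalyticMetricOn (finPart K) traceMetric where
  toIsAnalyticPseudoMetricOn := isAnalyticPseudoMetricOn_traceMetric
  definite E hE S h := by
    have h1 := sq_norm_le_traceMetric hE S
    rw [h] at h1
    exact norm_eq_zero.1 (pow_eq_zero_iff two_ne_zero |>.1 (le_antisymm h1 (sq_nonneg _)))
  bounded_below E hE :=
    ⟨1, one_pos, fun S => (one_mul (‖S‖ ^ 2)).trans_le (sq_norm_le_traceMetric hE S)⟩

end Grassmannian

end

open AnalyticBanachManifold in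
theorem mainTheorem5 {K : Type u} [NormedAddCommGroup K] [InnerProductSpace ℝ K]
    [CompleteSpace K] :
    -- (a)
    (IsAnalyticImmersion (Grassmannian.tangentEmbedding K) ∧
      (∀ E : Grassmannian K,
        (∀ T : TangentSp E, (Grassmannian.tangentEmbedding K ⟨E, T⟩).1 = E) ∧
        IsLinearMap ℝ (fun T : TangentSp E => (Grassmannian.tangentEmbedding K ⟨E, T⟩).2)) ∧
      IsEmbedding (Grassmannian.tangentEmbedding K) ∧
      range (Grassmannian.tangentEmbedding K) = {p | p.2 ∈ Grassmannian.fibre p.1} ∧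
      IsAnalyticSubbundle (fun E : Grassmannian K => E.fibre)) ∧
    -- (b)
    ((∀ x : K, IsAnalyticPseudoMetricOn univ (Grassmannian.vecMetric x)) ∧
      IsSeparating (fun x : K => Grassmannian.vecMetric x) ∧
      (TopologicalSpace.SeparableSpace K →
        ∃ x : ℕ → K, IsSeparating (fun n => Grassmannian.vecMetric (x n)))) ∧
    -- (c)
    (IsOpen (Grassmannian.finPart K) ∧
      (∀ E ∈ Grassmannian.finPart K, ∀ S T : TangentSp E,
        FiniteDimensional ℝ (Grassmannian.opMetric E S T).range) ∧
      IsAnalyticMetricOn (Grassmannian.finPart K) Grassmannian.traceMetric) :=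
  ⟨⟨Grassmannian.isAnalyticImmersion_tangentEmbedding,
      fun E => ⟨fun _ => rfl, Grassmannian.isLinearMap_extend E⟩,
      Grassmannian.isEmbedding_tangentEmbedding, Grassmannian.range_tangentEmbedding,
      Grassmannian.isAnalyticSubbundle_fibre⟩,
    ⟨Grassmannian.isAnalyticPseudoMetricOn_vecMetric,
      Grassmannian.isSeparating_of_denseRange denseRange_id,
      fun _ => ⟨TopologicalSpace.denseSeq K,
        Grassmannian.isSeparating_of_denseRange (TopologicalSpace.denseRange_denseSeq K)⟩⟩,
    Grassmannian.isOpen_finPart,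
    fun _ hE S T => Grassmannian.finiteDimensional_range_opMetric hE S T,
    Grassmannian.isAnalyticMetricOn_traceMetric⟩
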